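/- Let $M$ be a finite-dimensional smooth manifold (Hausdorff, $\sigma$-compact) and let $j$ be any almost complex structure on $M$, i.e. a smooth section of $\operatorname{End}(TM)$ with $j^2=-\mathrm{Id}$. Write $\mathfrak X(M)$ for the smooth real vector fields, $\mathcal T_j^{1,0}$ and $\mathcal T_j^{0,1}$ for the spaces of smooth sections of the $\pm i$-eigenbundles of $j$ in $TM\otimes\mathbb C$, and $\Omega^k(M,\mathbb C)=\bigoplus_{p+q=k}\Omega_j^{p,q}$ for the splitting of complex forms by type. The exterior derivative splits as $d=\bar\mu+\bar\partial+\partial+\mu$ with components of bidegrees $(-1,2),(0,1),(1,0),(2,-1)$. *Generalized Dolbeault cohomology.* Let $H_{\bar\mu}^{(p,q)}=\operatorname{Ker}\bar\mu|_{\Omega_j^{p,q}}/\operatorname{Im}\bar\mu|_{\Omega_j^{p+1,q-2}}$. The operator $\bar\partial$ induces $\widetilde{\bar\partial}:H_{\bar\mu}^{(p,q)}\to H_{\bar\mu}^{(p,q+1)}$ with square zero, and $$H_{Dol}^{(p,q)}(M)=\operatorname{Ker}\widetilde{\bar\partial}|_{H_{\bar\mu}^{(p,q)}}\big/\operatorname{Im}\widetilde{\bar\partial}|_{H_{\bar\mu}^{(p,q-1)}}.$$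 *Transverse Dolbeault cohomology.* Let $N^j(X,Y)=[jX,jY]-j[jX,Y]-j[X,jY]+j^2[X,Y]$. Let $\mathcal D_j^{(1)}$ be the space of smooth vector fields whose value at each point lies in the span of the values of $N^j$ there, let $$\mathcal D_j^{(k+1)}=\mathcal D_j^{(k)}+\sum_{U\in\mathcal D_j^{(k)}}\operatorname{Im}(\mathcal L_Uj)+[\mathcal D_j^{(k)},\mathcal D_j^{(k)}],\qquad (\mathcal L_Uj)X=[U,jX]-j[U,X],$$ and let $\mathcal D_j^\infty=\bigcup_k\mathcal D_j^{(k)}$. Put $\Omega_{\mathcal D_j^\infty}^{p,q}=\{\omega\in\Omega_j^{p,q} : \iota(X)\omega=0,\ \mathcal L_X\omega=0\ \ \forall X\in\mathcal D_j^\infty\}$ and $$H_{j,\mathrm{trans}}^{p,q}(M)=\operatorname{Ker}\bar\partial|_{\Omega_{\mathcal D_j^\infty}^{p,q}}\big/\operatorname{Im}\bar\partial|_{\Omega_{\mathcal D_j^\infty}^{p,q-1}}.$$ *Complex limit distribution.* Let $(\mathcal T_j^{0,1})^{(0)}=\mathcal T_j^{0,1}$, $(\mathcal T_j^{0,1})^{(k+1)}=(\mathcal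 T_j^{0,1})^{(k)}+[(\mathcal T_j^{0,1})^{(k)},(\mathcal T_j^{0,1})^{(k)}]$, and $(\mathcal T_j^{0,1})^\infty=\bigcup_k(\mathcal T_j^{0,1})^{(k)}$. **Claim.** For every integer $p\ge 0$, the two cohomology spaces coincide in bidegree $(p,0)$: $$H_{Dol}^{(p,0)}(M)=H_{j,\mathrm{trans}}^{p,0}(M),$$ in the sense that there is a $\mathbb C$-linear isomorphism $H_{j,\mathrm{trans}}^{p,0}(M)\to H_{Dol}^{(p,0)}(M)$ which sends the class of a form $\omega$ to the class of the same form $\omega$. Moreover each of the two spaces is identified with $$\mathcal B^p=\{\omega\in\Omega^p(M,\mathbb C) : \iota(Z)\omega=0,\ \mathcal L_Z\omega=0\ \ \forall Z\in(\mathcal T_j^{0,1})^\infty\}:$$ the forms in $\Omega_{\mathcal D_j^\infty}^{p,0}$ with $\bar\partial\omega=0$ are exactly the elements of $\mathcal B^p$, and $\omega\mapsto[\omega]$ is a bijection $\mathcal B^p\to H_{j,\mathrm{trans}}^{p,0}(M)$; likewise the forms $\omega\in\Omega_j^{p,0}$ with $\bar\mu\omega=0$ that represent an element of $\operatorname{Ker}\widetilde{\bar\partial}$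 are exactly the elements of $\mathcal B^p$, and passing to classes is a bijection $\mathcal B^p\to H_{Dol}^{(p,0)}(M)$. -/

import Mathlib

open scoped Manifold ContDiff

set_option linter.unusedSectionVars false

noncomputable section

namespace AlmostComplex

section Basic

variable (E : Type*) [NormedAddCommGroup E] [NormedSpace ℝ E] [FiniteDimensional ℝ E]
  (M : Type*) [TopologicalSpace M] [ChartedSpace E M] [IsManifold 𝓘(ℝ, E) ∞ M]

/-! ### Smooth functions and vector fields -/

/-- Smooth real vector fields on `M`: smooth sections of the tangent bundle. -/
abbrev RealVectorField : Type _ :=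
  Cₛ^∞⟮𝓘(ℝ, E); E, (TangentSpace 𝓘(ℝ, E) : M → Type _)⟯

/-- The smooth complex-valued functions on `M`, as a subalgebra of all functions. -/
def smoothSubalgebra : Subalgebra ℂ (M → ℂ) where
  carrier := {f | ContMDiff 𝓘(ℝ, E) 𝓘(ℝ, ℂ) ∞ f}
  mul_mem' {f g} hf hg := by
    have : ContMDiff 𝓘(ℝ, ℂ × ℂ) 𝓘(ℝ, ℂ) ∞ (fun z : ℂ × ℂ => z.1 * z.2) :=
      (contDiff_fst.mul contDiff_snd).contMDiff
    exact this.comp (hf.prodMk_space hg)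
  add_mem' {f g} hf hg := by
    have : ContMDiff 𝓘(ℝ, ℂ × ℂ) 𝓘(ℝ, ℂ) ∞ (fun z : ℂ × ℂ => z.1 + z.2) :=
      (contDiff_fst.add contDiff_snd).contMDiff
    exact this.comp (hf.prodMk_space hg)
  algebraMap_mem' c := contMDiff_const

/-- The algebra `C^∞(M, ℂ)` of smooth complex-valued functions on `M`. -/
def SmoothFun : Type _ := smoothSubalgebra E M

instance : CommRing (SmoothFun E M) := inferInstanceAs (CommRing (smoothSubalgebra E M))

instance : Algebra ℂ (SmoothFun E M) := inferInstanceAs (Algebra ℂ (smoothSubalgebra E M))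

/-- Smooth complex vector fields on `M`, i.e. smooth sections of `TM ⊗ ℂ = TM ⊕ i TM`: the pair
`(X, Y)` of real vector fields stands for `X + i Y`. -/
def ComplexVectorField : Type _ := RealVectorField E M × RealVectorField E M

instance : AddCommGroup (ComplexVectorField E M) :=
  inferInstanceAs (AddCommGroup (RealVectorField E M × RealVectorField E M))

variable {E M}

/-- The real part `X` of `X + i Y`. -/
def ComplexVectorField.re (Z : ComplexVectorField E M) : RealVectorField E M := Z.1

/-- The imaginary part `Y` of `X + i Y`. -/
def ComplexVectorField.im (Z : ComplexVectorField E M) : RealVectorField E M := Z.2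

/-- The complex vector field `X + i Y`. -/
def cvf (X Y : RealVectorField E M) : ComplexVectorField E M := (X, Y)

@[simp] theorem cvf_re (X Y : RealVectorField E M) : (cvf X Y).re = X := rfl
@[simp] theorem cvf_im (X Y : RealVectorField E M) : (cvf X Y).im = Y := rfl
@[simp] theorem add_re (Z W : ComplexVectorField E M) : (Z + W).re = Z.re + W.re := rfl
@[simp] theorem add_im (Z W : ComplexVectorField E M) : (Z + W).im = Z.im + W.im := rfl
@[simp] theorem zero_re : (0 : ComplexVectorField E M).re = 0 := rfl
@[simp] theorem zero_im : (0 : ComplexVectorField E M).im = 0 := rfl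

theorem fun_ext {f g : SmoothFun E M} (h : ∀ x, f.1 x = g.1 x) : f = g :=
  Subtype.ext (funext h)

@[simp] theorem fun_add (f g : SmoothFun E M) (x : M) : (f + g).1 x = f.1 x + g.1 x := rfl
@[simp] theorem fun_mul (f g : SmoothFun E M) (x : M) : (f * g).1 x = f.1 x * g.1 x := rfl
@[simp] theorem fun_zero (x : M) : (0 : SmoothFun E M).1 x = 0 := rfl
@[simp] theorem fun_one (x : M) : (1 : SmoothFun E M).1 x = 1 := rfl
@[simp] theorem fun_const (c : ℂ) (x : M) : (algebraMap ℂ (SmoothFun E M) c).1 x = c := rfl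

theorem cvf_ext {Z W : ComplexVectorField E M} (h₁ : ∀ x, Z.re x = W.re x)
    (h₂ : ∀ x, Z.im x = W.im x) : Z = W :=
  Prod.ext (ContMDiffSection.ext h₁) (ContMDiffSection.ext h₂)

theorem contMDiff_re (f : SmoothFun E M) : ContMDiff 𝓘(ℝ, E) 𝓘(ℝ, ℝ) ∞ fun x => (f.1 x).re :=
  (Complex.reCLM.contDiff.contMDiff (n := ∞)).comp f.2

theorem contMDiff_im (f : SmoothFun E M) : ContMDiff 𝓘(ℝ, E) 𝓘(ℝ, ℝ) ∞ fun x => (f.1 x).im :=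
  (Complex.imCLM.contDiff.contMDiff (n := ∞)).comp f.2

/-- The product of the real part of a smooth function with a real vector field. -/
def reSmul (f : SmoothFun E M) (X : RealVectorField E M) : RealVectorField E M :=
  ⟨(fun x => (f.1 x).re) • (X : ∀ x, TangentSpace 𝓘(ℝ, E) x),
    (contMDiff_re f).smul_section X.contMDiff⟩

/-- The product of the imaginary part of a smooth function with a real vector field. -/
def imSmul (f : SmoothFun E M) (X : RealVectorField E M) : RealVectorField E M :=
  ⟨(fun x => (f.1 x).im) • (X : ∀ x, TangentSpace 𝓘(ℝ, E) x),
    (contMDiff_im f).smul_section X.contMDiff⟩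

@[simp] theorem reSmul_apply (f : SmoothFun E M) (X : RealVectorField E M) (x : M) :
    reSmul f X x = (f.1 x).re • X x := rfl
@[simp] theorem imSmul_apply (f : SmoothFun E M) (X : RealVectorField E M) (x : M) :
    imSmul f X x = (f.1 x).im • X x := rfl

/-- `(u + i v) (X + i Y) = (u X - v Y) + i (u Y + v X)`. -/
instance : SMul (SmoothFun E M) (ComplexVectorField E M) where
  smul f Z := cvf (reSmul f Z.re - imSmul f Z.im) (reSmul f Z.im + imSmul f Z.re)

@[simp] theorem smul_re (f : SmoothFun E M) (Z : ComplexVectorField E M) :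
    (f • Z).re = reSmul f Z.re - imSmul f Z.im := rfl
@[simp] theorem smul_im (f : SmoothFun E M) (Z : ComplexVectorField E M) :
    (f • Z).im = reSmul f Z.im + imSmul f Z.re := rfl

/-- Complex vector fields form a module over `C^∞(M, ℂ)`. -/
instance : Module (SmoothFun E M) (ComplexVectorField E M) where
  one_smul Z := by apply cvf_ext <;> intro x <;> simp
  mul_smul f g Z := by
    apply cvf_ext <;> intro x <;> simp [mul_smul, sub_smul, add_smul, smul_sub, smul_add] <;> abel
  smul_zero f := by apply cvf_ext <;> intro x <;> simp
  smul_add f Z W := by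
    apply cvf_ext <;> intro x <;> simp [smul_add] <;> abel
  add_smul f g Z := by
    apply cvf_ext <;> intro x <;> simp [add_smul] <;> abel
  zero_smul Z := by apply cvf_ext <;> intro x <;> simp

instance : Module ℂ (ComplexVectorField E M) :=
  Module.compHom (ComplexVectorField E M) (algebraMap ℂ (SmoothFun E M))

theorem complex_smul_def (c : ℂ) (Z : ComplexVectorField E M) :
    c • Z = algebraMap ℂ (SmoothFun E M) c • Z := rfl

instance : IsScalarTower ℂ (SmoothFun E M) (ComplexVectorField E M) where
  smul_assoc c f Z := by rw [complex_smul_def, smul_smul, Algebra.smul_def]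

/-! ### Lie bracket and derivation of functions -/

variable (E M) in
theorem isManifold_two : IsManifold 𝓘(ℝ, E) (minSmoothness ℝ 2) M := by
  rw [minSmoothness_of_isRCLikeNormedField]
  infer_instance

/-- The Lie bracket of two smooth real vector fields. -/
def realBracket (X Y : RealVectorField E M) : RealVectorField E M :=
  ⟨VectorField.mlieBracket 𝓘(ℝ, E) X Y, by
    have := FiniteDimensional.complete ℝ E
    have := isManifold_two E M
    have : IsManifold 𝓘(ℝ, E) (((⊤ : ℕ∞) : WithTop ℕ∞) + 1) M := by
      rw [show (((⊤ : ℕ∞) : WithTop ℕ∞) + 1) = ∞ from rfl]; infer_instance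
    exact ContDiff.mlieBracket_vectorField (m := ⊤) (n := ⊤) X.contMDiff Y.contMDiff (by simp)⟩

theorem realBracket_apply (X Y : RealVectorField E M) (x : M) :
    realBracket X Y x = VectorField.mlieBracket 𝓘(ℝ, E) X Y x := rfl

theorem mdiffAt_vectorField (X : RealVectorField E M) (x : M) :
    MDifferentiableAt 𝓘(ℝ, E) (𝓘(ℝ, E).prod 𝓘(ℝ, E))
      (fun y => (Bundle.TotalSpace.mk' E y (X y) : TangentBundle 𝓘(ℝ, E) M)) x :=
  (X.contMDiff x).mdifferentiableAt (by simp)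

theorem mdiffAt_fun (f : SmoothFun E M) (x : M) : MDifferentiableAt 𝓘(ℝ, E) 𝓘(ℝ, ℂ) f.1 x :=
  (ContMDiff.contMDiffAt f.2).mdifferentiableAt (by simp)

theorem realBracket_swap (X Y : RealVectorField E M) :
    realBracket X Y = -realBracket Y X := by
  ext x
  exact VectorField.mlieBracket_swap_apply

theorem realBracket_add_right (X Y Y' : RealVectorField E M) :
    realBracket X (Y + Y') = realBracket X Y + realBracket X Y' := by
  ext x
  have := FiniteDimensional.complete ℝ E
  have := isManifold_two E M
  exact VectorField.mlieBracket_add_right (mdiffAt_vectorField Y x) (mdiffAt_vectorField Y' x)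

theorem realBracket_neg_right (X Y : RealVectorField E M) :
    realBracket X (-Y) = -realBracket X Y := by
  have h := realBracket_add_right X Y (-Y)
  have h0 := realBracket_add_right X 0 0
  simp only [add_zero, left_eq_add] at h0
  rw [add_neg_cancel, h0] at h
  exact (neg_eq_of_add_eq_zero_right h.symm).symm

theorem realBracket_sub_right (X Y Y' : RealVectorField E M) :
    realBracket X (Y - Y') = realBracket X Y - realBracket X Y' := by
  rw [sub_eq_add_neg, realBracket_add_right, realBracket_neg_right, sub_eq_add_neg]

theorem mvfderiv_re (f : SmoothFun E M) (x : M) (v : TangentSpace 𝓘(ℝ, E) x) :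
    mvfderiv 𝓘(ℝ, E) (fun y => (f.1 y).re) x v = (mvfderiv 𝓘(ℝ, E) f.1 x v).re := by
  have h := (Complex.reCLM.hasFDerivAt (x := f.1 x)).hasMFDerivAt.comp x
    (mdiffAt_fun f x).hasMFDerivAt
  have h' := h.mfderiv
  exact congrArg (fun L => L v) h'

theorem mvfderiv_im (f : SmoothFun E M) (x : M) (v : TangentSpace 𝓘(ℝ, E) x) :
    mvfderiv 𝓘(ℝ, E) (fun y => (f.1 y).im) x v = (mvfderiv 𝓘(ℝ, E) f.1 x v).im := by
  have h := (Complex.imCLM.hasFDerivAt (x := f.1 x)).hasMFDerivAt.comp x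
    (mdiffAt_fun f x).hasMFDerivAt
  have h' := h.mfderiv
  exact congrArg (fun L => L v) h'

theorem realBracket_reSmul_right (X Y : RealVectorField E M) (f : SmoothFun E M) (x : M) :
    realBracket X (reSmul f Y) x =
      (mvfderiv 𝓘(ℝ, E) f.1 x (X x)).re • Y x + (f.1 x).re • realBracket X Y x := by
  have := FiniteDimensional.complete ℝ E
  have := isManifold_two E M
  rw [← mvfderiv_re]
  exact VectorField.mlieBracket_smul_right (I := 𝓘(ℝ, E)) (V := X) (W := Y)
    (f := fun x => (f.1 x).re) (x := x) ((contMDiff_re f x).mdifferentiableAt (by simp))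
    (mdiffAt_vectorField Y x)

theorem realBracket_imSmul_right (X Y : RealVectorField E M) (f : SmoothFun E M) (x : M) :
    realBracket X (imSmul f Y) x =
      (mvfderiv 𝓘(ℝ, E) f.1 x (X x)).im • Y x + (f.1 x).im • realBracket X Y x := by
  have := FiniteDimensional.complete ℝ E
  have := isManifold_two E M
  rw [← mvfderiv_im]
  exact VectorField.mlieBracket_smul_right (I := 𝓘(ℝ, E)) (V := X) (W := Y)
    (f := fun x => (f.1 x).im) (x := x) ((contMDiff_im f x).mdifferentiableAt (by simp))
    (mdiffAt_vectorField Y x)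

/-- The derivative `Z f = df(X) + i df(Y)` of a smooth complex function `f` in the direction of the
complex vector field `Z = X + i Y`. -/
def act (Z : ComplexVectorField E M) (f : SmoothFun E M) : SmoothFun E M :=
  ⟨fun x => mvfderiv 𝓘(ℝ, E) f.1 x (Z.re x) + Complex.I * mvfderiv 𝓘(ℝ, E) f.1 x (Z.im x), by
    have h (X : RealVectorField E M) : (fun x => mvfderiv 𝓘(ℝ, E) f.1 x (X x)) ∈ smoothSubalgebra E M :=
      (contMDiff_snd_tangentBundle_modelSpace ℂ 𝓘(ℝ, ℂ)).comp
        ((f.2.contMDiff_tangentMap (m := ∞) (by simp)).comp X.contMDiff)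
    exact add_mem (h Z.re) (mul_mem ((smoothSubalgebra E M).algebraMap_mem Complex.I) (h Z.im))⟩

theorem act_apply (Z : ComplexVectorField E M) (f : SmoothFun E M) (x : M) :
    (act Z f).1 x =
      mvfderiv 𝓘(ℝ, E) f.1 x (Z.re x) + Complex.I * mvfderiv 𝓘(ℝ, E) f.1 x (Z.im x) := rfl

/-- The complex bilinear extension of the Lie bracket to complex vector fields. -/
def bracket (Z W : ComplexVectorField E M) : ComplexVectorField E M :=
  cvf (realBracket Z.re W.re - realBracket Z.im W.im)
    (realBracket Z.re W.im + realBracket Z.im W.re)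

theorem bracket_add_right (Z W W' : ComplexVectorField E M) :
    bracket Z (W + W') = bracket Z W + bracket Z W' := by
  apply cvf_ext <;> intro x <;> simp [bracket, realBracket_add_right] <;> abel

theorem bracket_swap (Z W : ComplexVectorField E M) : bracket Z W = -bracket W Z := by
  rw [eq_neg_iff_add_eq_zero]
  apply cvf_ext <;> intro x <;>
    simp [bracket, realBracket_swap Z.re, realBracket_swap Z.im]

theorem bracket_add_left (Z Z' W : ComplexVectorField E M) :
    bracket (Z + Z') W = bracket Z W + bracket Z' W := by
  rw [bracket_swap, bracket_add_right, bracket_swap Z, bracket_swap Z', neg_add]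

theorem bracket_self (Z : ComplexVectorField E M) : bracket Z Z = 0 := by
  have hre : realBracket Z.re Z.re = 0 := by ext x; simp [realBracket_apply]
  have him : realBracket Z.im Z.im = 0 := by ext x; simp [realBracket_apply]
  apply cvf_ext <;> intro x <;> simp [bracket, hre, him, realBracket_swap Z.im]

theorem bracket_smul_right (Z W : ComplexVectorField E M) (f : SmoothFun E M) :
    bracket Z (f • W) = f • bracket Z W + act Z f • W := by
  apply cvf_ext <;> intro x <;>
    simp [bracket, realBracket_add_right, realBracket_sub_right, realBracket_reSmul_right,
      realBracket_imSmul_right, act_apply] <;> module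

theorem bracket_smul_left (Z W : ComplexVectorField E M) (f : SmoothFun E M) :
    bracket (f • Z) W = f • bracket Z W - act W f • Z := by
  rw [bracket_swap, bracket_smul_right, bracket_swap Z W, smul_neg]; abel

theorem act_add_left (Z Z' : ComplexVectorField E M) (f : SmoothFun E M) :
    act (Z + Z') f = act Z f + act Z' f := by
  apply fun_ext; intro x
  simp [act_apply]; ring

theorem act_smul_left (g : SmoothFun E M) (Z : ComplexVectorField E M) (f : SmoothFun E M) :
    act (g • Z) f = g * act Z f := by
  apply fun_ext; intro x
  have hg : g.1 x = ((g.1 x).re : ℂ) + ((g.1 x).im : ℂ) * Complex.I := (Complex.re_add_im _).symm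
  simp only [fun_mul, act_apply, smul_re, smul_im,
    ContMDiffSection.coe_sub, ContMDiffSection.coe_add, Pi.sub_apply, Pi.add_apply, reSmul_apply,
    imSmul_apply, map_sub, map_add, map_smul, Complex.real_smul]
  rw [hg]
  simp only [Complex.add_re, Complex.add_im, Complex.ofReal_re, Complex.ofReal_im, Complex.mul_re,
    Complex.mul_im, Complex.I_re, Complex.I_im, mul_zero, mul_one, sub_zero, add_zero, zero_add]
  linear_combination -(((g.1 x).im : ℂ) * mvfderiv 𝓘(ℝ, E) f.1 x (Z.im x)) * Complex.I_mul_I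

theorem act_add (Z : ComplexVectorField E M) (f g : SmoothFun E M) :
    act Z (f + g) = act Z f + act Z g := by
  apply fun_ext; intro x
  have h : mvfderiv 𝓘(ℝ, E) (f.1 + g.1) x = mvfderiv 𝓘(ℝ, E) f.1 x + mvfderiv 𝓘(ℝ, E) g.1 x :=
    mvfderiv_add (mdiffAt_fun f x) (mdiffAt_fun g x)
  have h' : (f + g).1 = f.1 + g.1 := rfl
  simp only [fun_add, act_apply, h', h, add_apply]
  ring

theorem act_mul (Z : ComplexVectorField E M) (f g : SmoothFun E M) :
    act Z (f * g) = f * act Z g + act Z f * g := by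
  apply fun_ext; intro x
  have h (v : TangentSpace 𝓘(ℝ, E) x) : mvfderiv 𝓘(ℝ, E) (f.1 * g.1) x v =
      f.1 x * mvfderiv 𝓘(ℝ, E) g.1 x v + g.1 x * mvfderiv 𝓘(ℝ, E) f.1 x v :=
    congrArg (fun L => L v)
      ((mdiffAt_fun f x).hasMFDerivAt.mul (mdiffAt_fun g x).hasMFDerivAt).mfderiv
  have h' : (f * g).1 = f.1 * g.1 := rfl
  simp only [fun_add, fun_mul, act_apply, h', h]
  ring

theorem act_zero (Z : ComplexVectorField E M) : act Z 0 = 0 := by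
  have h := act_add Z 0 0
  simpa using h

theorem act_const (Z : ComplexVectorField E M) (c : ℂ) :
    act Z (algebraMap ℂ (SmoothFun E M) c) = 0 := by
  apply fun_ext; intro x
  have h : mvfderiv 𝓘(ℝ, E) (algebraMap ℂ (SmoothFun E M) c).1 x = 0 := mvfderiv_const c
  rw [act_apply, h]
  simp

theorem act_smul (Z : ComplexVectorField E M) (c : ℂ) (f : SmoothFun E M) :
    act Z (c • f) = c • act Z f := by
  rw [Algebra.smul_def, act_mul, act_const, zero_mul, add_zero, Algebra.smul_def]

/-! ### Complex differential forms -/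

variable (E M) in
/-- Smooth complex `k`-forms on `M`, i.e. smooth sections of `Λ^k (TM ⊗ ℂ)^*`, given by their
values on vector fields: alternating `C^∞(M, ℂ)`-multilinear maps from complex vector fields to
smooth complex functions. -/
abbrev Form (k : ℕ) : Type _ :=
  AlternatingMap (SmoothFun E M) (ComplexVectorField E M) (SmoothFun E M) (Fin k)

instance (k : ℕ) : AddCommGroup (Form E M k) := inferInstance

/-- The contraction `ι(Z) α`; it vanishes on functions. -/
def interior (Z : ComplexVectorField E M) : (k : ℕ) → Form E M k → Form E M (k - 1)
  | 0, _ => 0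
  | _ + 1, α => α.curryLeft Z

/-- The Lie derivative
`(L_Z α)(Z₁, …, Z_k) = Z (α(Z₁, …, Z_k)) - ∑ⱼ α(Z₁, …, [Z, Zⱼ], …, Z_k)`. -/
def lieDerivFun {k : ℕ} (Z : ComplexVectorField E M) (α : Form E M k)
    (v : Fin k → ComplexVectorField E M) : SmoothFun E M :=
  act Z (α v) - ∑ j, α (Function.update v j (bracket Z (v j)))

theorem lieDerivFun_add {k : ℕ} (Z : ComplexVectorField E M) (α : Form E M k)
    (v : Fin k → ComplexVectorField E M) (i : Fin k) (x y : ComplexVectorField E M) :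
    lieDerivFun Z α (Function.update v i (x + y)) =
      lieDerivFun Z α (Function.update v i x) + lieDerivFun Z α (Function.update v i y) := by
  have key : ∀ j, α (Function.update (Function.update v i (x + y)) j
        (bracket Z (Function.update v i (x + y) j))) =
      α (Function.update (Function.update v i x) j (bracket Z (Function.update v i x j))) +
      α (Function.update (Function.update v i y) j (bracket Z (Function.update v i y j))) := by
    intro j
    by_cases h : j = i
    · subst h; simp [bracket_add_right]
    · simp only [Function.update_of_ne h]
      rw [Function.update_comm (Ne.symm h), Function.update_comm (Ne.symm h),
        Function.update_comm (Ne.symm h),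
        AlternatingMap.map_update_add]
  simp only [lieDerivFun, AlternatingMap.map_update_add, act_add, key, Finset.sum_add_distrib]
  abel

theorem lieDerivFun_smul {k : ℕ} (Z : ComplexVectorField E M) (α : Form E M k)
    (v : Fin k → ComplexVectorField E M) (i : Fin k) (f : SmoothFun E M)
    (x : ComplexVectorField E M) :
    lieDerivFun Z α (Function.update v i (f • x)) =
      f • lieDerivFun Z α (Function.update v i x) := by
  have key : ∀ j, α (Function.update (Function.update v i (f • x)) j
        (bracket Z (Function.update v i (f • x) j))) =
      f • α (Function.update (Function.update v i x) j (bracket Z (Function.update v i x j))) +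
      if j = i then act Z f * α (Function.update v i x) else 0 := by
    intro j
    by_cases h : j = i
    · subst h; simp [bracket_smul_right]
    · simp only [Function.update_of_ne h, if_neg h, add_zero]
      rw [Function.update_comm (Ne.symm h), Function.update_comm (Ne.symm h),
        AlternatingMap.map_update_smul]
  simp only [lieDerivFun, AlternatingMap.map_update_smul, smul_eq_mul, act_mul, key,
    Finset.sum_add_distrib, Finset.sum_ite_eq', Finset.mem_univ, if_true, ← Finset.mul_sum]
  ring

theorem lieDerivFun_eq_zero {k : ℕ} (Z : ComplexVectorField E M) (α : Form E M k)
    (v : Fin k → ComplexVectorField E M) (i j : Fin k) (h : v i = v j) (hij : i ≠ j) :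
    lieDerivFun Z α v = 0 := by
  have h1 : α v = 0 := α.map_eq_zero_of_eq v h hij
  have h2 : ∑ l, α (Function.update v l (bracket Z (v l))) =
      α (Function.update v i (bracket Z (v i))) + α (Function.update v j (bracket Z (v j))) := by
    rw [← Finset.sum_pair (f := fun l => α (Function.update v l (bracket Z (v l)))) hij]
    refine (Finset.sum_subset (Finset.subset_univ _) ?_).symm
    intro l _ hl
    simp only [Finset.mem_insert, Finset.mem_singleton, not_or] at hl
    refine α.map_eq_zero_of_eq _ (i := i) (j := j) ?_ hij
    rw [Function.update_of_ne (Ne.symm hl.1), Function.update_of_ne (Ne.symm hl.2), h]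
  have h3 : Function.update v j (bracket Z (v j)) =
      Function.update v i (bracket Z (v i)) ∘ Equiv.swap i j := by
    funext l
    by_cases hl : l = i
    · subst hl; simp [Function.update_of_ne hij, Function.update_of_ne hij.symm, h]
    · by_cases hl' : l = j
      · subst hl'; simp [h]
      · simp [Equiv.swap_apply_of_ne_of_ne hl hl', Function.update_of_ne hl,
          Function.update_of_ne hl']
  rw [lieDerivFun, h1, h2, h3, α.map_swap _ hij, act_zero]
  simp

/-- The Lie derivative of a form along a complex vector field. -/
def lieDeriv {k : ℕ} (Z : ComplexVectorField E M) (α : Form E M k) : Form E M k where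
  toFun := lieDerivFun Z α
  map_update_add' {d} v i x y := by
    rw [Subsingleton.elim d (instDecidableEqFin k)]; exact lieDerivFun_add Z α v i x y
  map_update_smul' {d} v i f x := by
    rw [Subsingleton.elim d (instDecidableEqFin k)]; exact lieDerivFun_smul Z α v i f x
  map_eq_zero_of_eq' v i j h hij := lieDerivFun_eq_zero Z α v i j h hij

theorem lieDeriv_apply {k : ℕ} (Z : ComplexVectorField E M) (α : Form E M k)
    (v : Fin k → ComplexVectorField E M) :
    lieDeriv Z α v = act Z (α v) - ∑ j, α (Function.update v j (bracket Z (v j))) := rfl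

/-- The value of the exterior derivative on vector fields,
`dα(Z₀, …, Z_k) = ∑ᵢ (-1)^i Zᵢ (α(Z₀, …, Ẑᵢ, …, Z_k))
  + ∑_{i < j} (-1)^(i+j) α([Zᵢ, Zⱼ], Z₀, …, Ẑᵢ, …, Ẑⱼ, …, Z_k)`,
where in the second sum the entry `[Zᵢ, Zⱼ]` is moved to the place of `Zⱼ`, which turns the sign
`(-1)^(i+j)` into `-(-1)^i`. -/
def koszul {k : ℕ} (α : Form E M k) (v : Fin (k + 1) → ComplexVectorField E M) : SmoothFun E M :=
  ∑ i : Fin (k + 1), (-1) ^ (i : ℕ) *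
    (act (v i) (α (i.removeNth v)) -
      ∑ j ∈ Finset.Ioi i, α (i.removeNth (Function.update v j (bracket (v i) (v j)))))

theorem removeNth_succ_cons {k : ℕ} {V : Type*} (i : Fin (k + 1)) (z : V) (v : Fin (k + 1) → V) :
    i.succ.removeNth (Fin.cons z v : Fin (k + 2) → V) = Fin.cons z (i.removeNth v) := by
  funext l
  refine Fin.cases ?_ (fun l => ?_) l
  · simp [Fin.removeNth]
  · simp [Fin.removeNth]

theorem koszul_succ {k : ℕ} (α : Form E M (k + 1)) (Z : ComplexVectorField E M)
    (v : Fin (k + 1) → ComplexVectorField E M) :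
    koszul α (Fin.cons Z v : Fin (k + 2) → ComplexVectorField E M) =
      lieDeriv Z α v - koszul (α.curryLeft Z) v := by
  have h0 : Finset.Ioi (0 : Fin (k + 2)) = Finset.univ.map (Fin.succEmb (k + 1)) :=
    Fin.Ioi_zero_eq_map
  have hs (i : Fin (k + 1)) : Finset.Ioi i.succ = (Finset.Ioi i).map (Fin.succEmb (k + 1)) :=
    (Fin.map_succEmb_Ioi i).symm
  rw [koszul, Fin.sum_univ_succ, lieDeriv_apply, koszul, sub_eq_add_neg (_ - _) (∑ _, _),
    ← Finset.sum_neg_distrib]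
  congr 1
  · rw [h0, Finset.sum_map]
    simp only [Fin.val_zero, pow_zero, one_mul, Fin.cons_zero, Fin.coe_succEmb, Fin.cons_succ,
      ← Fin.cons_update, Fin.removeNth_zero, Fin.tail_cons]
  · refine Finset.sum_congr rfl fun i _ => ?_
    rw [hs, Finset.sum_map]
    simp only [Fin.val_succ, pow_succ, Fin.cons_succ, Fin.coe_succEmb, ← Fin.cons_update,
      removeNth_succ_cons]
    simp only [AlternatingMap.curryLeft_apply_apply, Matrix.vecCons]
    ring

theorem koszul_zero (α : Form E M 0) (v : Fin 1 → ComplexVectorField E M) :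
    koszul α v = act (v 0) (α Fin.elim0) := by
  simp [koszul, Subsingleton.elim (Fin.removeNth 0 v) Fin.elim0]

theorem koszul_add {k : ℕ} (α β : Form E M k) (v : Fin (k + 1) → ComplexVectorField E M) :
    koszul (α + β) v = koszul α v + koszul β v := by
  simp only [koszul, AlternatingMap.add_apply, act_add, Finset.sum_add_distrib]
  rw [← Finset.sum_add_distrib]
  exact Finset.sum_congr rfl fun i _ => by ring

theorem koszul_fun_smul {k : ℕ} (f : SmoothFun E M) (α : Form E M k)
    (v : Fin (k + 1) → ComplexVectorField E M) :
    koszul (f • α) v =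
      f * koszul α v + ∑ i : Fin (k + 1), (-1) ^ (i : ℕ) * (act (v i) f * α (i.removeNth v)) := by
  simp only [koszul, AlternatingMap.smul_apply, smul_eq_mul, act_mul, Finset.mul_sum]
  rw [← Finset.sum_add_distrib]
  refine Finset.sum_congr rfl fun i _ => ?_
  rw [← Finset.mul_sum]
  ring

theorem koszul_smul {k : ℕ} (c : ℂ) (α : Form E M k) (v : Fin (k + 1) → ComplexVectorField E M) :
    koszul (c • α) v = c • koszul α v := by
  simp only [koszul, AlternatingMap.smul_apply, act_smul, ← Finset.smul_sum, ← smul_sub,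
    mul_smul_comm]

theorem lieDeriv_add_left {k : ℕ} (Z Z' : ComplexVectorField E M) (α : Form E M k)
    (v : Fin k → ComplexVectorField E M) :
    lieDeriv (Z + Z') α v = lieDeriv Z α v + lieDeriv Z' α v := by
  simp only [lieDeriv_apply, act_add_left, bracket_add_left, AlternatingMap.map_update_add,
    Finset.sum_add_distrib]
  ring

theorem map_update_eq {k : ℕ} (α : Form E M (k + 1)) (Z : ComplexVectorField E M)
    (v : Fin (k + 1) → ComplexVectorField E M) (j : Fin (k + 1)) :
    α (Function.update v j Z) = (-1) ^ (j : ℕ) * α.curryLeft Z (j.removeNth v) := by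
  rw [← Fin.insertNth_removeNth, AlternatingMap.map_insertNth, AlternatingMap.curryLeft_apply_apply]
  simp

theorem lieDeriv_smul_left {k : ℕ} (f : SmoothFun E M) (Z : ComplexVectorField E M)
    (α : Form E M (k + 1)) (v : Fin (k + 1) → ComplexVectorField E M) :
    lieDeriv (f • Z) α v = f * lieDeriv Z α v +
      ∑ i : Fin (k + 1), (-1) ^ (i : ℕ) * (act (v i) f * α.curryLeft Z (i.removeNth v)) := by
  have hb (W : ComplexVectorField E M) :
      bracket (f • Z) W = f • bracket Z W + (-act W f) • Z := by
    rw [bracket_smul_left, neg_smul, sub_eq_add_neg]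
  simp only [lieDeriv_apply, act_smul_left, hb, sub_eq_add_neg, AlternatingMap.map_update_add, AlternatingMap.map_update_smul, smul_eq_mul,
    Finset.sum_add_distrib, mul_add, ← Finset.mul_sum, neg_add]
  have key : ∑ i, -(-act (v i) f * α (Function.update v i Z)) =
      ∑ i : Fin (k + 1), (-1) ^ (i : ℕ) * (act (v i) f * α.curryLeft Z (i.removeNth v)) := by
    refine Finset.sum_congr rfl fun i _ => ?_
    rw [map_update_eq]
    ring
  rw [← Finset.sum_neg_distrib, key]
  ring

theorem lieDeriv_curryLeft {k : ℕ} (Z W : ComplexVectorField E M) (α : Form E M (k + 1))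
    (v : Fin k → ComplexVectorField E M) :
    lieDeriv Z α (Fin.cons W v : Fin (k + 1) → ComplexVectorField E M) =
      lieDeriv Z (α.curryLeft W) v - α.curryLeft (bracket Z W) v := by
  simp only [lieDeriv_apply, Fin.sum_univ_succ, Fin.cons_zero, Fin.cons_succ, ← Fin.cons_update,
    Fin.update_cons_zero, AlternatingMap.curryLeft_apply_apply, Matrix.vecCons]
  ring

theorem exists_koszul : ∀ (k : ℕ) (α : Form E M k), ∃ D : Form E M (k + 1), ∀ v, D v = koszul α v
  | 0, α => by
    refine ⟨⟨⟨fun v => act (v 0) (α Fin.elim0), ?_, ?_⟩, ?_⟩, fun v => (koszul_zero α v).symm⟩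
    · intro _ v i x y
      obtain rfl := Fin.fin_one_eq_zero i
      simp [act_add_left]
    · intro _ v i f x
      obtain rfl := Fin.fin_one_eq_zero i
      simp [act_smul_left]
    · intro v i j _ hij
      exact absurd ((Fin.fin_one_eq_zero i).trans (Fin.fin_one_eq_zero j).symm) hij
  | k + 1, α => by
    choose D hD using fun Z => exists_koszul k (α.curryLeft Z)
    let G : ComplexVectorField E M →ₗ[SmoothFun E M] Form E M (k + 1) :=
      { toFun := fun Z => lieDeriv Z α - D Z
        map_add' := fun Z Z' => by
          ext1 v
          simp only [AlternatingMap.sub_apply, AlternatingMap.add_apply, hD, lieDeriv_add_left,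
            map_add, koszul_add]
          ring
        map_smul' := fun f Z => by
          ext1 v
          simp only [AlternatingMap.sub_apply, AlternatingMap.smul_apply, hD, lieDeriv_smul_left,
            map_smul, koszul_fun_smul, RingHom.id_apply, smul_eq_mul]
          ring }
    have hG (v : Fin (k + 2) → ComplexVectorField E M) : G (v 0) (Fin.tail v) = koszul α v := by
      conv_rhs => rw [← Fin.cons_self_tail v]
      rw [koszul_succ]
      simp [G, hD]
    have hself (Z : ComplexVectorField E M) (w : Fin k → ComplexVectorField E M) :
        G Z (Fin.cons Z w : Fin (k + 1) → ComplexVectorField E M) = 0 := by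
      have h1 : G Z (Fin.cons Z w : Fin (k + 1) → ComplexVectorField E M) =
          lieDeriv Z (α.curryLeft Z) w -
            koszul (α.curryLeft Z) (Fin.cons Z w : Fin (k + 1) → ComplexVectorField E M) := by
        have h2 := lieDeriv_curryLeft Z Z α w
        rw [bracket_self, map_zero, AlternatingMap.zero_apply, sub_zero] at h2
        simp only [G, LinearMap.coe_mk, AddHom.coe_mk, AlternatingMap.sub_apply, hD, h2]
      rw [h1]
      match k, α, w with
      | 0, α, w =>
        rw [koszul_zero, lieDeriv_apply]
        simp [Subsingleton.elim w Fin.elim0]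
      | k + 1, α, w =>
        rw [koszul_succ, AlternatingMap.curryLeft_same]
        have h0 : koszul (0 : Form E M k) w = 0 := by simp [koszul, act_zero]
        rw [h0]; ring
    let μ : MultilinearMap (SmoothFun E M) (fun _ : Fin (k + 2) => ComplexVectorField E M)
        (SmoothFun E M) :=
      ((AlternatingMap.toMultilinearMapLM (S := SmoothFun E M)).comp G).uncurryLeft
    refine ⟨⟨μ, ?_⟩, fun v => hG v⟩
    intro v i j hv hij
    change G (v 0) (Fin.tail v) = 0
    have hz (j : Fin (k + 1)) (hj : v 0 = v j.succ) : G (v 0) (Fin.tail v) = 0 := by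
      have hcons (u : Fin (k + 1) → ComplexVectorField E M) (hu : u 0 = v 0) : G (v 0) u = 0 := by
        rw [← Fin.cons_self_tail u, hu]; exact hself _ _
      by_cases h : (0 : Fin (k + 1)) = j
      · subst h; exact hcons _ hj.symm
      · have h3 := (G (v 0)).map_swap (Fin.tail v) h
        rw [hcons _ (by simp [Fin.tail, hj])] at h3
        exact neg_eq_zero.mp h3.symm
    induction i using Fin.cases with
    | zero =>
      induction j using Fin.cases with
      | zero => exact absurd rfl hij
      | succ j => exact hz j hv
    | succ i =>
      induction j using Fin.cases with
      | zero => exact hz i hv.symm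
      | succ j => exact (G (v 0)).map_eq_zero_of_eq _ (i := i) (j := j) hv (by simpa using hij)

theorem extD_aux {k : ℕ} (α : Form E M k) : ∃ D : Form E M (k + 1), ⇑D = koszul α :=
  (exists_koszul k α).imp fun _ h => funext h

/-- The exterior derivative `d : Ω^k(M, ℂ) → Ω^(k+1)(M, ℂ)`. -/
def extD (k : ℕ) : Form E M k →ₗ[ℂ] Form E M (k + 1) where
  toFun α :=
    { toFun := koszul α
      map_update_add' := fun v i x y => by
        obtain ⟨D, hD⟩ := extD_aux α
        rw [← hD]; exact D.map_update_add v i x y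
      map_update_smul' := fun v i f x => by
        obtain ⟨D, hD⟩ := extD_aux α
        rw [← hD]; exact D.map_update_smul v i f x
      map_eq_zero_of_eq' := fun v i j h hij => by
        obtain ⟨D, hD⟩ := extD_aux α
        rw [← hD]; exact D.map_eq_zero_of_eq v h hij }
  map_add' α β := by ext1 v; exact koszul_add α β v
  map_smul' c α := by ext1 v; exact koszul_smul c α v

theorem extD_apply {k : ℕ} (α : Form E M k) (v : Fin (k + 1) → ComplexVectorField E M) :
    extD k α v = koszul α v := rfl

theorem interior_add (k : ℕ) (Z : ComplexVectorField E M) (α β : Form E M k) :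
    interior Z k (α + β) = interior Z k α + interior Z k β := by
  cases k with
  | zero => simp [interior]
  | succ k => rfl

theorem interior_smul (k : ℕ) (Z : ComplexVectorField E M) (c : ℂ) (α : Form E M k) :
    interior Z k (c • α) = c • interior Z k α := by
  cases k with
  | zero => simp [interior]
  | succ k => rfl

theorem lieDeriv_add (k : ℕ) (Z : ComplexVectorField E M) (α β : Form E M k) :
    lieDeriv Z (α + β) = lieDeriv Z α + lieDeriv Z β := by
  ext1 v
  simp only [lieDeriv_apply, AlternatingMap.add_apply, act_add, Finset.sum_add_distrib]
  ring

theorem lieDeriv_smul (k : ℕ) (Z : ComplexVectorField E M) (c : ℂ) (α : Form E M k) :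
    lieDeriv Z (c • α) = c • lieDeriv Z α := by
  ext1 v
  simp only [lieDeriv_apply, AlternatingMap.smul_apply, act_smul, ← Finset.smul_sum, smul_sub]

/-- The `k`-forms `α` with `ι(Z) α = 0` and `L_Z α = 0` for all `Z` in a set of complex vector
fields. -/
def basicForms (k : ℕ) (D : Set (ComplexVectorField E M)) : Submodule ℂ (Form E M k) where
  carrier := {α | ∀ Z ∈ D, interior Z k α = 0 ∧ lieDeriv Z α = 0}
  add_mem' {α β} hα hβ Z hZ := by
    rw [interior_add, lieDeriv_add, (hα Z hZ).1, (hα Z hZ).2, (hβ Z hZ).1, (hβ Z hZ).2]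
    simp
  zero_mem' Z _ := by
    have h1 := interior_smul k Z 0 0
    have h2 := lieDeriv_smul k Z 0 0
    simp only [zero_smul] at h1 h2
    exact ⟨h1, h2⟩
  smul_mem' c α hα Z hZ := by
    rw [interior_smul, lieDeriv_smul, (hα Z hZ).1, (hα Z hZ).2]
    simp

end Basic

/-! ### Almost complex structures and types of forms -/

/-- An almost complex structure on `M`: a smooth section `j` of `End(TM)` with `j² = -id`. -/
structure AlmostComplexStructure (E : Type*) [NormedAddCommGroup E] [NormedSpace ℝ E]
    (M : Type*) [TopologicalSpace M] [ChartedSpace E M] [IsManifold 𝓘(ℝ, E) ∞ M] where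
  /-- The endomorphism of each tangent space. -/
  toEnd : ∀ x : M, TangentSpace 𝓘(ℝ, E) x →L[ℝ] TangentSpace 𝓘(ℝ, E) x
  smooth : ContMDiff 𝓘(ℝ, E) (𝓘(ℝ, E).prod 𝓘(ℝ, E →L[ℝ] E)) ∞
    (fun x => Bundle.TotalSpace.mk' (E →L[ℝ] E)
      (E := fun x : M => TangentSpace 𝓘(ℝ, E) x →L[ℝ] TangentSpace 𝓘(ℝ, E) x) x (toEnd x))
  sq : ∀ (x : M) (v : TangentSpace 𝓘(ℝ, E) x), toEnd x (toEnd x v) = -v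

section Structure

variable {E : Type*} [NormedAddCommGroup E] [NormedSpace ℝ E] [FiniteDimensional ℝ E]
  {M : Type*} [TopologicalSpace M] [ChartedSpace E M] [IsManifold 𝓘(ℝ, E) ∞ M]
  (j : AlmostComplexStructure E M)

namespace AlmostComplexStructure

/-- The vector field `jX`. -/
def onReal (X : RealVectorField E M) : RealVectorField E M :=
  ⟨fun x => j.toEnd x (X x), j.smooth.clm_bundle_apply X.contMDiff⟩

@[simp] theorem onReal_apply (X : RealVectorField E M) (x : M) :
    j.onReal X x = j.toEnd x (X x) := rfl

/-- The complex linear extension `j(X + i Y) = jX + i jY`. -/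
def onComplex : ComplexVectorField E M →ₗ[SmoothFun E M] ComplexVectorField E M where
  toFun Z := cvf (j.onReal Z.re) (j.onReal Z.im)
  map_add' Z W := by apply cvf_ext <;> intro x <;> simp
  map_smul' f Z := by apply cvf_ext <;> intro x <;> simp

theorem onComplex_smul (c : ℂ) (Z : ComplexVectorField E M) :
    j.onComplex (c • Z) = c • j.onComplex Z :=
  map_smul j.onComplex (algebraMap ℂ (SmoothFun E M) c) Z

/-- Sections of `T_j^{1,0}`, the `i`-eigenbundle of `j` in `TM ⊗ ℂ`. -/
def T10 : Submodule ℂ (ComplexVectorField E M) where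
  carrier := {Z | j.onComplex Z = Complex.I • Z}
  add_mem' {Z W} hZ hW := by
    simp only [Set.mem_ofPred_eq] at *
    rw [map_add, hZ, hW, smul_add]
  zero_mem' := by simp
  smul_mem' c Z hZ := by
    simp only [Set.mem_ofPred_eq] at *
    rw [onComplex_smul, hZ, smul_comm]

/-- Sections of `T_j^{0,1}`, the `-i`-eigenbundle of `j` in `TM ⊗ ℂ`. -/
def T01 : Submodule ℂ (ComplexVectorField E M) where
  carrier := {Z | j.onComplex Z = -(Complex.I • Z)}
  add_mem' {Z W} hZ hW := by
    simp only [Set.mem_ofPred_eq] at *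
    rw [map_add, hZ, hW, smul_add, neg_add]
  zero_mem' := by simp
  smul_mem' c Z hZ := by
    simp only [Set.mem_ofPred_eq] at *
    rw [onComplex_smul, hZ, smul_neg, smul_comm]

/-- The projection `Z ↦ (Z - i jZ) / 2` onto `T_j^{1,0}` along `T_j^{0,1}`. -/
def proj10 : ComplexVectorField E M →ₗ[SmoothFun E M] ComplexVectorField E M :=
  algebraMap ℂ (SmoothFun E M) (1 / 2) •
    (LinearMap.id - algebraMap ℂ (SmoothFun E M) Complex.I • j.onComplex)

/-- The projection `Z ↦ (Z + i jZ) / 2` onto `T_j^{0,1}` along `T_j^{1,0}`. -/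
def proj01 : ComplexVectorField E M →ₗ[SmoothFun E M] ComplexVectorField E M :=
  algebraMap ℂ (SmoothFun E M) (1 / 2) •
    (LinearMap.id + algebraMap ℂ (SmoothFun E M) Complex.I • j.onComplex)

/-- The forms of type `(p, q)` among the `k`-forms: those which vanish on every family of sections
of `T_j^{1,0}` and `T_j^{0,1}`, unless exactly `p` members are taken from the former and `q` from
the latter. (This is the zero space unless `p, q ≥ 0` and `p + q = k`.) -/
def typeForms (k : ℕ) (p q : ℤ) : Submodule ℂ (Form E M k) where
  carrier := {α | ∀ (S : Finset (Fin k)) (Z : Fin k → ComplexVectorField E M),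
    ¬ ((S.card : ℤ) = p ∧ (Sᶜ.card : ℤ) = q) →
    (∀ i ∈ S, Z i ∈ j.T10) → (∀ i ∉ S, Z i ∈ j.T01) → α Z = 0}
  add_mem' {α β} hα hβ S Z h h1 h2 := by
    simp [hα S Z h h1 h2, hβ S Z h h1 h2]
  zero_mem' S Z h h1 h2 := rfl
  smul_mem' c α hα S Z h h1 h2 := by
    simp [hα S Z h h1 h2]

open Classical in
/-- The value of the `(p, q)`-component of a `k`-form `α` on vector fields: the sum, over all
choices `S` of `p` arguments whose complement has `q` elements, of the value of `α` on the
`T_j^{1,0}`-parts of the arguments in `S` and the `T_j^{0,1}`-parts of the others. -/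
def typeProjFun {k : ℕ} (p q : ℤ) (α : Form E M k) (Z : Fin k → ComplexVectorField E M) :
    SmoothFun E M :=
  ∑ S : Finset (Fin k) with (S.card : ℤ) = p ∧ (Sᶜ.card : ℤ) = q,
    α fun i => if i ∈ S then j.proj10 (Z i) else j.proj01 (Z i)

theorem typeProjFun_eq_zero {k : ℕ} (p q : ℤ) (α : Form E M k)
    (Z : Fin k → ComplexVectorField E M) (a b : Fin k) (h : Z a = Z b) (hab : a ≠ b) :
    j.typeProjFun p q α Z = 0 := by
  classical
  refine Finset.sum_involution (fun S _ => S.map (Equiv.swap a b).toEmbedding) ?_ ?_ ?_ ?_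
  · intro S _
    have hsw : (fun i => if i ∈ S.map (Equiv.swap a b).toEmbedding then j.proj10 (Z i)
        else j.proj01 (Z i)) =
        (fun i => if i ∈ S then j.proj10 (Z i) else j.proj01 (Z i)) ∘ Equiv.swap a b := by
      funext i
      have hZ : Z (Equiv.swap a b i) = Z i := by
        rcases eq_or_ne i a with rfl | hia
        · simp [h]
        · rcases eq_or_ne i b with rfl | hib
          · simp [h]
          · rw [Equiv.swap_apply_of_ne_of_ne hia hib]
      simp only [Function.comp_apply, hZ, Finset.mem_map_equiv, Equiv.symm_swap]
    convert add_neg_cancel _ using 2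
    rw [hsw, α.map_swap _ hab]
  · intro S _ hne hS
    apply hne
    refine α.map_eq_zero_of_eq _ (i := a) (j := b) ?_ hab
    have : a ∈ S ↔ b ∈ S := by
      conv_lhs => rw [← hS]
      simp [Finset.mem_map_equiv]
    simp [this, h]
  · intro S hS
    simp only [Finset.mem_filter, Finset.mem_univ, true_and, Finset.card_compl,
      Finset.card_map] at hS ⊢
    exact hS
  · intro S _
    ext i
    simp [Finset.mem_map_equiv]

theorem typeProjFun_add {k : ℕ} (p q : ℤ) (α β : Form E M k) (Z : Fin k → ComplexVectorField E M) :
    j.typeProjFun p q (α + β) Z = j.typeProjFun p q α Z + j.typeProjFun p q β Z := by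
  simp [typeProjFun, Finset.sum_add_distrib]

theorem typeProjFun_smul {k : ℕ} (p q : ℤ) (c : ℂ) (α : Form E M k)
    (Z : Fin k → ComplexVectorField E M) :
    j.typeProjFun p q (c • α) Z = c • j.typeProjFun p q α Z := by
  simp [typeProjFun, Finset.smul_sum]

theorem typeProj_aux {k : ℕ} (p q : ℤ) (α : Form E M k) :
    ∃ D : MultilinearMap (SmoothFun E M) (fun _ : Fin k => ComplexVectorField E M)
      (SmoothFun E M), ⇑D = j.typeProjFun p q α := by
  classical
  refine ⟨∑ S : Finset (Fin k) with (S.card : ℤ) = p ∧ (Sᶜ.card : ℤ) = q,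
    α.toMultilinearMap.compLinearMap fun i => if i ∈ S then j.proj10 else j.proj01, ?_⟩
  funext Z
  rw [_root_.sum_apply, typeProjFun]
  refine Finset.sum_congr (by congr) fun S _ => ?_
  rw [MultilinearMap.compLinearMap_apply]
  change α _ = α _
  congr 1
  funext i
  by_cases h : i ∈ S <;> simp [h]

/-- The projection `π^{p,q} : Ω^k(M, ℂ) → Ω_j^{p,q}` to the component of type `(p, q)`. -/
def typeProj (k : ℕ) (p q : ℤ) : Form E M k →ₗ[ℂ] Form E M k where
  toFun α :=
    { toFun := j.typeProjFun p q α
      map_update_add' := fun v i x y => by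
        obtain ⟨D, hD⟩ := j.typeProj_aux p q α
        rw [← hD]; exact D.map_update_add v i x y
      map_update_smul' := fun v i f x => by
        obtain ⟨D, hD⟩ := j.typeProj_aux p q α
        rw [← hD]; exact D.map_update_smul v i f x
      map_eq_zero_of_eq' := fun Z a b h hab => j.typeProjFun_eq_zero p q α Z a b h hab }
  map_add' α β := by
    ext1 Z
    exact j.typeProjFun_add p q α β Z
  map_smul' c α := by
    ext1 Z
    exact j.typeProjFun_smul p q c α Z

/-! ### The generalized Dolbeault cohomology -/

/-- The component `μ̄` of bidegree `(-1, 2)` of `d`, as a map on `k`-forms of type `(p, q)`. -/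
def muBar (k : ℕ) (p q : ℤ) : Form E M k →ₗ[ℂ] Form E M (k + 1) :=
  j.typeProj (k + 1) (p - 1) (q + 2) ∘ₗ extD k

/-- The component `∂̄` of bidegree `(0, 1)` of `d`, as a map on `k`-forms of type `(p, q)`. -/
def delBar (k : ℕ) (p q : ℤ) : Form E M k →ₗ[ℂ] Form E M (k + 1) :=
  j.typeProj (k + 1) p (q + 1) ∘ₗ extD k

/-- `Ker μ̄` on `Ω_j^{p,q}`, where `p + q = k`. -/
def muKer (k : ℕ) (p q : ℤ) : Submodule ℂ (Form E M k) :=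
  j.typeForms k p q ⊓ LinearMap.ker (j.muBar k p q)

/-- `μ̄(Ω_j^{p+1,q-2})` inside the forms of degree `p + q = k`. -/
def muIm : (k : ℕ) → ℤ → ℤ → Submodule ℂ (Form E M k)
  | 0, _, _ => ⊥
  | k + 1, p, q => (j.typeForms k (p + 1) (q - 2)).map (j.muBar k (p + 1) (q - 2))

/-- `H_μ̄^{p,q} = Ker μ̄|Ω^{p,q} / Im μ̄|Ω^{p+1,q-2}`, in degree `k = p + q`. -/
abbrev MuCohomology (k : ℕ) (p q : ℤ) : Type _ :=
  j.muKer k p q ⧸ (j.muIm k p q).submoduleOf (j.muKer k p q)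

/-- Representatives of the kernel of the induced map `[α] ↦ [∂̄ α]` from `H_μ̄^{p,q}` to
`H_μ̄^{p,q+1}`: forms `α` in `Ω_j^{p,q}` with `μ̄ α = 0` and `∂̄ α ∈ μ̄(Ω_j^{p+1,q-1})`. -/
def dolCocycles (k : ℕ) (p q : ℤ) : Submodule ℂ (Form E M k) :=
  j.muKer k p q ⊓ (j.muIm (k + 1) p (q + 1)).comap (j.delBar k p q)

/-- Representatives of the image of the induced map `[β] ↦ [∂̄ β]` from `H_μ̄^{p,q-1}` to
`H_μ̄^{p,q}`: forms `∂̄ β` with `β` in `Ω_j^{p,q-1}` and `μ̄ β = 0`. -/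
def dolBoundaries : (k : ℕ) → ℤ → ℤ → Submodule ℂ (Form E M k)
  | 0, _, _ => ⊥
  | k + 1, p, q => (j.muKer k p (q - 1)).map (j.delBar k p (q - 1))

/-- The kernel, in `H_μ̄^{p,q}`, of the map to `H_μ̄^{p,q+1}` induced by `∂̄`. -/
def dolKer (k : ℕ) (p q : ℤ) : Submodule ℂ (j.MuCohomology k p q) :=
  ((j.dolCocycles k p q).submoduleOf (j.muKer k p q)).map (Submodule.mkQ _)

/-- The image, in `H_μ̄^{p,q}`, of the map from `H_μ̄^{p,q-1}` induced by `∂̄`. -/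
def dolIm (k : ℕ) (p q : ℤ) : Submodule ℂ (j.MuCohomology k p q) :=
  ((j.dolBoundaries k p q).submoduleOf (j.muKer k p q)).map (Submodule.mkQ _)

/-- The generalized Dolbeault cohomology `H_Dol^{p,q}(M)`, in degree `k = p + q`: the cohomology
of the map induced by `∂̄` on `H_μ̄`. -/
abbrev DolCohomology (k : ℕ) (p q : ℤ) : Type _ :=
  j.dolKer k p q ⧸ (j.dolIm k p q).submoduleOf (j.dolKer k p q)

/-- The class `[α]` in `H_μ̄^{p,q}` of a form `α` in `dolCocycles`; it lies in `dolKer`. -/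
def dolKerMk (k : ℕ) (p q : ℤ) : j.dolCocycles k p q →ₗ[ℂ] j.dolKer k p q :=
  LinearMap.codRestrict (j.dolKer k p q)
    ((Submodule.mkQ _) ∘ₗ
      (Submodule.inclusion (inf_le_left : j.dolCocycles k p q ≤ j.muKer k p q)))
    (fun α => Submodule.mem_map_of_mem (by exact α.2))

/-- The class `[[α]]` in `H_Dol^{p,q}(M)` of a form `α` in `dolCocycles`. -/
def dolClass (k : ℕ) (p q : ℤ) : j.dolCocycles k p q →ₗ[ℂ] j.DolCohomology k p q :=
  (Submodule.mkQ _) ∘ₗ j.dolKerMk k p q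

/-! ### The limit distributions -/

/-- The Nijenhuis tensor `N^j(X, Y) = [jX, jY] - j[jX, Y] - j[X, jY] + j²[X, Y]`. -/
def nijenhuis (X Y : RealVectorField E M) : RealVectorField E M :=
  realBracket (j.onReal X) (j.onReal Y) - j.onReal (realBracket (j.onReal X) Y) -
    j.onReal (realBracket X (j.onReal Y)) + j.onReal (j.onReal (realBracket X Y))

/-- The space of smooth sections of `Im N^j`: smooth vector fields whose value at every point `x`
lies in the span of the values `N^j(X, Y)(x)`. -/
def imNijenhuis : Submodule ℝ (RealVectorField E M) where
  carrier := {W | ∀ x, W x ∈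
    Submodule.span ℝ {v : TangentSpace 𝓘(ℝ, E) x | ∃ X Y, v = j.nijenhuis X Y x}}
  add_mem' hV hW x := Submodule.add_mem _ (hV x) (hW x)
  zero_mem' _ := Submodule.zero_mem _
  smul_mem' c _ hW x := Submodule.smul_mem _ c (hW x)

/-- `(L_U j) X = [U, jX] - j[U, X]`. -/
def lieDerivJ (U X : RealVectorField E M) : RealVectorField E M :=
  realBracket U (j.onReal X) - j.onReal (realBracket U X)

/-- `derivedReal k` is `D_j^{(k+1)}`, where `D_j^{(1)} = Im N^j` and
`D_j^{(k+1)} = D_j^{(k)} + ∑_{U ∈ D_j^{(k)}} Im(L_U j) + [D_j^{(k)}, D_j^{(k)}]`. -/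
def derivedReal : ℕ → Submodule ℝ (RealVectorField E M)
  | 0 => j.imNijenhuis
  | k + 1 => derivedReal k ⊔
      Submodule.span ℝ {W | ∃ U ∈ derivedReal k, ∃ X, W = j.lieDerivJ U X} ⊔
      Submodule.span ℝ {W | ∃ U ∈ derivedReal k, ∃ U' ∈ derivedReal k, W = realBracket U U'}

/-- The real limit distribution `D_j^∞ = ⋃ₖ D_j^{(k)}`. -/
def limitReal : Set (RealVectorField E M) := ⋃ k, (j.derivedReal k : Set (RealVectorField E M))

/-- The derived flag of `T_j^{0,1}`: `T^{(0)}` is the space of sections of `T_j^{0,1}` and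
`T^{(k+1)} = T^{(k)} + [T^{(k)}, T^{(k)}]`. -/
def derivedT01 : ℕ → Submodule ℂ (ComplexVectorField E M)
  | 0 => j.T01
  | k + 1 => derivedT01 k ⊔
      Submodule.span ℂ {W | ∃ Z ∈ derivedT01 k, ∃ Z' ∈ derivedT01 k, W = bracket Z Z'}

/-- The complex limit distribution `(T_j^{0,1})^∞ = ⋃ₖ (T_j^{0,1})^{(k)}`. -/
def limitT01 : Set (ComplexVectorField E M) :=
  ⋃ k, (j.derivedT01 k : Set (ComplexVectorField E M))

/-! ### The transverse Dolbeault cohomology -/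

/-- `Ω_{D_j^∞}^{p,q}`: the forms `α` of type `(p, q)` with `ι(X) α = 0` and `L_X α = 0` for all
`X ∈ D_j^∞`. -/
def transForms (k : ℕ) (p q : ℤ) : Submodule ℂ (Form E M k) :=
  j.typeForms k p q ⊓ basicForms k ((fun X => cvf X 0) '' j.limitReal)

/-- The kernel of `∂̄` on `Ω_{D_j^∞}^{p,q}`. -/
def transCocycles (k : ℕ) (p q : ℤ) : Submodule ℂ (Form E M k) :=
  j.transForms k p q ⊓ LinearMap.ker (j.delBar k p q)

/-- The image of `∂̄` on `Ω_{D_j^∞}^{p,q-1}`. -/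
def transBoundaries : (k : ℕ) → ℤ → ℤ → Submodule ℂ (Form E M k)
  | 0, _, _ => ⊥
  | k + 1, p, q => (j.transForms k p (q - 1)).map (j.delBar k p (q - 1))

/-- The `j`-transverse Dolbeault cohomology `H_{j,trans}^{p,q}(M)`, in degree `k = p + q`. -/
abbrev TransCohomology (k : ℕ) (p q : ℤ) : Type _ :=
  j.transCocycles k p q ⧸ (j.transBoundaries k p q).submoduleOf (j.transCocycles k p q)

/-- The class in `H_{j,trans}^{p,q}(M)` of a form in `transCocycles`. -/
def transClass (k : ℕ) (p q : ℤ) : j.transCocycles k p q →ₗ[ℂ] j.TransCohomology k p q :=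
  Submodule.mkQ _

/-- The complex `k`-forms `α` with `ι(Z) α = 0` and `L_Z α = 0` for all `Z ∈ (T_j^{0,1})^∞`. -/
def limitForms (k : ℕ) : Submodule ℂ (Form E M k) := basicForms k j.limitT01

end AlmostComplexStructure

end Structure

end AlmostComplex

end

/-! Both kinds of cocycles and the forms `limitForms` reduce to one condition on a `p`-form `α`:
every section of `T_j^{0,1}` is a null field of `α`, i.e. satisfies `ι(Z) α = 0` and `ι(Z) dα = 0`.

By Cartan's formula, null fields are equally the fields with `ι(Z) α = 0` and `L_Z α = 0`
(`mem_nullFields`). The first description shows that they form a `C^∞`-submodule with a pointwise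
character. The second shows that they are closed under brackets (`bracket_mem_nullFields`). Hence,
once they contain `T_j^{0,1}`, they contain its whole derived flag (`mem_limitForms_iff`).

Dolbeault side: in bidegree `(p, 0)` there are no boundaries, and the image of `μ̄` in bidegree `(p,
1)` is zero, so a cocycle is a `(p, 0)`-form with `μ̄ α = 0` and `∂̄ α = 0`. Components of `dα` with
more than two `(0, 1)`-arguments vanish automatically, so `dα` has type `(p + 1, 0)`, which is the
null condition (`mem_nullFields_of_mem_T01`).

Transverse side: modulo `T_j^{0,1}`, the bracket of two sections of `T_j^{0,1}` is minus a value of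
`N^j` (`bracket_add_nijenhuis_mem_T01`). If `α` is killed by `Im N^j`, it is therefore killed by
these brackets, which gives `μ̄ α = 0`; with `∂̄ α = 0` this is the previous situation. Conversely,
if `T_j^{0,1}` consists of null fields, so does `D_j^∞`: its generators come from sections of
`T_j^{0,1}` by brackets, complex multiples and pointwise spans (`limitReal_subset`). -/

noncomputable section

namespace AlmostComplex

variable {E : Type*} [NormedAddCommGroup E] [NormedSpace ℝ E] [FiniteDimensional ℝ E]
  {M : Type*} [TopologicalSpace M] [ChartedSpace E M] [IsManifold 𝓘(ℝ, E) ∞ M]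

/-! ### Locality of linear maps on vector fields -/

/-- A smooth real function, as a smooth complex function. -/
def ofRealFun (h : M → ℝ) (hh : ContMDiff 𝓘(ℝ, E) 𝓘(ℝ, ℝ) ∞ h) : SmoothFun E M :=
  ⟨fun x => (h x : ℂ), (Complex.ofRealCLM.contDiff.contMDiff (n := ∞)).comp hh⟩

@[simp] theorem ofRealFun_apply (h : M → ℝ) (hh : ContMDiff 𝓘(ℝ, E) 𝓘(ℝ, ℝ) ∞ h) (x : M) :
    (ofRealFun h hh).1 x = (h x : ℂ) := rfl

/-- Evaluation of vector fields at a point. -/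
def evalAt (x : M) : RealVectorField E M →ₗ[ℝ] TangentSpace 𝓘(ℝ, E) x where
  toFun X := X x
  map_add' _ _ := rfl
  map_smul' _ _ := rfl

theorem re_sum_apply {ι : Type*} [Fintype ι] (Z : ι → ComplexVectorField E M) (x : M) :
    (∑ i, Z i).re x = ∑ i, (Z i).re x :=
  map_sum ((evalAt x).toAddMonoidHom.comp (AddMonoidHom.fst _ (RealVectorField E M))) Z Finset.univ

theorem im_sum_apply {ι : Type*} [Fintype ι] (Z : ι → ComplexVectorField E M) (x : M) :
    (∑ i, Z i).im x = ∑ i, (Z i).im x :=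
  map_sum ((evalAt x).toAddMonoidHom.comp (AddMonoidHom.snd (RealVectorField E M) _)) Z Finset.univ

theorem fun_sum {ι : Type*} [Fintype ι] (f : ι → SmoothFun E M) (x : M) :
    (∑ i, f i).1 x = ∑ i, (f i).1 x := by
  have h : (∑ i, f i).1 = ∑ i, (f i).1 := map_sum (smoothSubalgebra E M).val f Finset.univ
  rw [h, Finset.sum_apply]

/-- Smooth real vector fields take arbitrary values at a point. -/
theorem exists_realVectorField_apply_eq [T2Space M] (x : M) (v : TangentSpace 𝓘(ℝ, E) x) :
    ∃ X : RealVectorField E M, X x = v := by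
  obtain ⟨s, hs, hsm⟩ := FiberBundle.exists_contMDiffOn_extend (k := ∞) 𝓘(ℝ, E) E v
  -- A bump function supported where the local extension of `v` is smooth makes the extension global
  -- without changing its value at `x`.
  obtain ⟨f, -, hf⟩ := (SmoothBumpFunction.nhds_basis_tsupport (I := 𝓘(ℝ, E)) x).mem_iff.1
    (interior_mem_nhds.2 hs)
  refine ⟨⟨_, ContMDiffOn.smul_section_of_tsupport f.contMDiff.contMDiffOn isOpen_interior hf
    (hsm.mono interior_subset)⟩, ?_⟩
  simp

/-- A vector field that vanishes at `x` is, near `x`, a combination of vector fields with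
coefficients that vanish at `x`. -/
theorem exists_smul_eq_sum_smul [T2Space M] (W : RealVectorField E M) (x : M) (hW : W x = 0) :
    ∃ (n : ℕ) (f : SmoothFun E M) (g : Fin n → SmoothFun E M) (S : Fin n → RealVectorField E M),
      f.1 x = 1 ∧ (∀ i, (g i).1 x = 0) ∧ f • cvf W 0 = ∑ i, g i • cvf (S i) 0 := by
  let e := trivializationAt E (TangentSpace 𝓘(ℝ, E) : M → Type _) x
  let b := Module.finBasis ℝ E
  obtain ⟨f⟩ : Nonempty (SmoothBumpFunction 𝓘(ℝ, E) x) := inferInstance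
  have hft : tsupport f ⊆ e.baseSet := f.tsupport_subset_chartAt_source
  have hS (i) := ContMDiffOn.smul_section_of_tsupport (f.contMDiff.contMDiffOn (s := e.baseSet))
    e.open_baseSet hft (e.contMDiffOn_localFrame_baseSet (I := 𝓘(ℝ, E)) ∞ b i)
  let S (i) : RealVectorField E M := ⟨_, hS i⟩
  have hc (i) := f.contMDiff_smul (contMDiffOn_baseSet_localFrameCoeff (I := 𝓘(ℝ, E)) (e := e)
    (k := ∞) b W.contMDiff.contMDiffOn i)
  -- The square of the bump function: one factor extends the local frame to global fields, the other
  -- extends the coefficients of `W` to global functions.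
  refine ⟨_, ofRealFun (fun y => f y * f y) (f.contMDiff.mul f.contMDiff),
    fun i => ofRealFun _ (hc i), S, by simp, fun i => by simp [hW], ?_⟩
  apply cvf_ext <;> intro y
  · by_cases hy : y ∈ e.baseSet
    · have hWy := Bundle.Trivialization.eq_sum_localFrameCoeff_smul (I := 𝓘(ℝ, E)) (b := b)
        (s := W) hy
      have hSy (i) : S i y = f y • e.localFrame b i y := rfl
      simp only [re_sum_apply, smul_re, cvf_re, cvf_im, ContMDiffSection.coe_sub, Pi.sub_apply,
        reSmul_apply, imSmul_apply, ofRealFun_apply, Complex.ofReal_re, Complex.ofReal_im,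
        zero_smul, sub_zero, hSy, smul_eq_mul, LinearMap.piApply_apply_apply]
      conv_lhs => rw [hWy, Finset.smul_sum]
      exact Finset.sum_congr rfl fun i _ => by module
    · have hfy : f y = 0 := image_eq_zero_of_notMem_tsupport fun h => hy (hft h)
      simp [re_sum_apply, hfy]
  · simp [im_sum_apply]

/-- Tensoriality: apply `L` to `f W = ∑ gᵢ Sᵢ` and evaluate at `x`, where `f = 1` and every `gᵢ`
vanishes. -/
theorem linearMap_apply_eq_zero [T2Space M]
    (L : ComplexVectorField E M →ₗ[SmoothFun E M] SmoothFun E M) (W : RealVectorField E M) (x : M)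
    (hW : W x = 0) : (L (cvf W 0)).1 x = 0 := by
  obtain ⟨n, f, g, S, hf, hg, h⟩ := exists_smul_eq_sum_smul W x hW
  have h' := congrArg (fun u : SmoothFun E M => u.1 x) (congrArg L h)
  simpa [fun_sum, hf, hg] using h'

theorem ofReal_smul_cvf (c : ℝ) (X : RealVectorField E M) :
    cvf (c • X) 0 = (c : ℂ) • cvf X 0 := by
  rw [complex_smul_def]
  apply cvf_ext <;> intro x <;> simp [-algebraMap_smul]

theorem cvf_add_zero (X Y : RealVectorField E M) : cvf (X + Y) 0 = cvf X 0 + cvf Y 0 := by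
  apply cvf_ext <;> intro x <;> simp

/-- A linear map on vector fields that vanishes on a set of real vector fields vanishes on the real
vector fields with values in the pointwise span of that set. -/
theorem linearMap_eq_zero_of_mem_span [T2Space M]
    (L : ComplexVectorField E M →ₗ[SmoothFun E M] SmoothFun E M) (A : Set (RealVectorField E M))
    (hA : ∀ X ∈ A, L (cvf X 0) = 0) (W : RealVectorField E M)
    (hW : ∀ x, W x ∈ Submodule.span ℝ {v : TangentSpace 𝓘(ℝ, E) x | ∃ X ∈ A, v = X x}) :
    L (cvf W 0) = 0 := by
  apply fun_ext
  intro x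
  -- The point `x` is fixed, so a real combination `X` of members of `A` can be found that agrees
  -- with `W` at `x` only; tensoriality then disposes of `W - X`.
  have hmap : W x ∈ (Submodule.span ℝ A).map (evalAt x) := by
    rw [Submodule.map_span]
    refine Submodule.span_mono ?_ (hW x)
    rintro v ⟨X, hX, rfl⟩
    exact ⟨X, hX, rfl⟩
  obtain ⟨X, hX, hXW⟩ := hmap
  have hLX : L (cvf X 0) = 0 := by
    clear hXW
    induction hX using Submodule.span_induction with
    | mem X hX => exact hA X hX
    | zero => exact map_zero L
    | add X Y _ _ hX hY => rw [cvf_add_zero, map_add, hX, hY, add_zero]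
    | smul c X _ hX => rw [ofReal_smul_cvf, complex_smul_def, map_smul, hX, smul_zero]
  have hd : (W - X) x = 0 := sub_eq_zero.2 hXW.symm
  have hWX : cvf W 0 = cvf (W - X) 0 + cvf X 0 := by rw [← cvf_add_zero, sub_add_cancel]
  rw [hWX, map_add, hLX, add_zero, linearMap_apply_eq_zero L _ x hd, fun_zero]

/-! ### The Jacobi identity and the commutator of Lie derivatives -/

theorem realBracket_add_left (X X' Y : RealVectorField E M) :
    realBracket (X + X') Y = realBracket X Y + realBracket X' Y := by
  rw [realBracket_swap, realBracket_add_right, realBracket_swap X, realBracket_swap X', neg_add]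

theorem realBracket_sub_left (X X' Y : RealVectorField E M) :
    realBracket (X - X') Y = realBracket X Y - realBracket X' Y := by
  rw [realBracket_swap, realBracket_sub_right, realBracket_swap X, realBracket_swap X']
  abel

theorem realBracket_jacobi (X Y Z : RealVectorField E M) :
    realBracket X (realBracket Y Z) =
      realBracket (realBracket X Y) Z + realBracket Y (realBracket X Z) := by
  ext x
  have := FiniteDimensional.complete ℝ E
  have : IsManifold 𝓘(ℝ, E) (minSmoothness ℝ 3) M := by
    rw [minSmoothness_of_isRCLikeNormedField]
    infer_instance
  have h (X : RealVectorField E M) : ContMDiffAt 𝓘(ℝ, E) (𝓘(ℝ, E).prod 𝓘(ℝ, E)) (minSmoothness ℝ 2)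
      (fun y => (Bundle.TotalSpace.mk' E y (X y) : TangentBundle 𝓘(ℝ, E) M)) x := by
    rw [minSmoothness_of_isRCLikeNormedField]
    exact (X.contMDiff x).of_le (WithTop.coe_le_coe.2 (le_top (α := ℕ∞)))
  exact VectorField.leibniz_identity_mlieBracket_apply (h X) (h Y) (h Z)

theorem bracket_jacobi (X Y Z : ComplexVectorField E M) :
    bracket X (bracket Y Z) = bracket (bracket X Y) Z + bracket Y (bracket X Z) := by
  refine Prod.ext ?_ ?_
  · change (bracket X (bracket Y Z)).re = (bracket (bracket X Y) Z + bracket Y (bracket X Z)).re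
    simp only [bracket, cvf_re, cvf_im, add_re, realBracket_add_left, realBracket_sub_left,
      realBracket_add_right, realBracket_sub_right]
    rw [realBracket_jacobi X.re Y.re Z.re, realBracket_jacobi X.re Y.im Z.im,
      realBracket_jacobi X.im Y.re Z.im, realBracket_jacobi X.im Y.im Z.re]
    abel
  · change (bracket X (bracket Y Z)).im = (bracket (bracket X Y) Z + bracket Y (bracket X Z)).im
    simp only [bracket, cvf_re, cvf_im, add_im, realBracket_add_left, realBracket_sub_left,
      realBracket_add_right, realBracket_sub_right]
    rw [realBracket_jacobi X.re Y.re Z.im, realBracket_jacobi X.re Y.im Z.re,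
      realBracket_jacobi X.im Y.re Z.re, realBracket_jacobi X.im Y.im Z.im]
    abel

/-- Derived from the Jacobi identity: expand it for `f X` and subtract `f` times the identity for
`X`. What remains is `([Z, W] f - Z (W f) + W (Z f)) X = 0`, and `X` can be chosen nonzero at any
given point. -/
theorem act_bracket [T2Space M] (Z W : ComplexVectorField E M) (f : SmoothFun E M) :
    act (bracket Z W) f = act Z (act W f) - act W (act Z f) := by
  apply fun_ext
  intro x
  -- In dimension zero no field is nonzero at `x`, but there all derivatives vanish.
  rcases subsingleton_or_nontrivial E with hE | hE
  · have hT : ∀ v : TangentSpace 𝓘(ℝ, E) x, v = 0 := fun v => Subsingleton.elim (α := E) v 0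
    have h (Z : ComplexVectorField E M) (f : SmoothFun E M) : (act Z f).1 x = 0 := by
      rw [act_apply, hT (Z.re x), hT (Z.im x)]
      simp
    change _ = (act Z (act W f)).1 x - (act W (act Z f)).1 x
    simp [h]
  · obtain ⟨v, hv⟩ := exists_ne (0 : E)
    obtain ⟨X, hX⟩ := exists_realVectorField_apply_eq x (v : TangentSpace 𝓘(ℝ, E) x)
    have h := bracket_jacobi Z W (f • cvf X 0)
    have h0 := congrArg (f • ·) (bracket_jacobi Z W (cvf X 0))
    simp only [bracket_smul_right, bracket_add_right, smul_add] at h h0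
    have key : (act (bracket Z W) f - (act Z (act W f) - act W (act Z f))) • cvf X 0 = 0 := by
      rw [sub_smul, sub_smul]
      linear_combination (norm := module) h0 - h
    set g := act (bracket Z W) f - (act Z (act W f) - act W (act Z f)) with hg
    have hgx : (g.1 x).re = 0 ∧ (g.1 x).im = 0 := by
      constructor
      · have h1 := congrArg (fun Z : ComplexVectorField E M => Z.re x) key
        simp only [smul_re, cvf_re, cvf_im, zero_re, ContMDiffSection.coe_sub, Pi.sub_apply,
          reSmul_apply, imSmul_apply, hX, ContMDiffSection.coe_zero, Pi.zero_apply, smul_zero,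
          sub_zero] at h1
        exact (smul_eq_zero.1 (show (g.1 x).re • (v : E) = 0 from h1)).resolve_right hv
      · have h1 := congrArg (fun Z : ComplexVectorField E M => Z.im x) key
        simp only [smul_im, cvf_re, cvf_im, zero_im, ContMDiffSection.coe_add, Pi.add_apply,
          reSmul_apply, imSmul_apply, hX, ContMDiffSection.coe_zero, Pi.zero_apply, smul_zero,
          zero_add] at h1
        exact (smul_eq_zero.1 (show (g.1 x).im • (v : E) = 0 from h1)).resolve_right hv
    exact sub_eq_zero.1 (Complex.ext hgx.1 hgx.2 : g.1 x = 0)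

theorem lieDeriv_sub (k : ℕ) (Z : ComplexVectorField E M) (α β : Form E M k) :
    lieDeriv Z (α - β) = lieDeriv Z α - lieDeriv Z β := by
  rw [eq_sub_iff_add_eq, ← lieDeriv_add, sub_add_cancel]

theorem curryLeft_lieDeriv {k : ℕ} (Z W : ComplexVectorField E M) (α : Form E M (k + 1)) :
    (lieDeriv Z α).curryLeft W = lieDeriv Z (α.curryLeft W) - α.curryLeft (bracket Z W) := by
  ext1 v
  exact lieDeriv_curryLeft Z W α v

/-- Induction on the degree, starting from `act_bracket`. Contracting with `U` and commuting `ι(U)`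
past the Lie derivatives by `ι(U) L_Z = L_Z ι(U) - ι([Z, U])` lowers the degree; the leftover
contractions cancel by the Jacobi identity. -/
theorem lieDeriv_bracket [T2Space M] : ∀ {k : ℕ} (Z W : ComplexVectorField E M) (α : Form E M k),
    lieDeriv (bracket Z W) α = lieDeriv Z (lieDeriv W α) - lieDeriv W (lieDeriv Z α)
  | 0, Z, W, α => by
    ext1 v
    simp [lieDeriv_apply, act_bracket]
  | k + 1, Z, W, α => by
    have hext {β γ : Form E M (k + 1)} (h : ∀ U, β.curryLeft U = γ.curryLeft U) : β = γ := by
      ext1 v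
      rw [← Fin.cons_self_tail v]
      exact congrArg (fun δ : Form E M k => δ (Fin.tail v)) (h (v 0))
    refine hext fun U => ?_
    have hsub (β γ : Form E M (k + 1)) : (β - γ).curryLeft U = β.curryLeft U - γ.curryLeft U := rfl
    simp only [hsub, curryLeft_lieDeriv, lieDeriv_sub, lieDeriv_bracket Z W (α.curryLeft U)]
    rw [bracket_jacobi Z W U, map_add]
    abel

/-! ### Null fields of a form -/

/-- The complex vector fields `Z` with `ι(Z) α = 0`. -/
def contractionKer : {k : ℕ} → Form E M k → Submodule (SmoothFun E M) (ComplexVectorField E M)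
  | 0, _ => ⊤
  | _ + 1, α => LinearMap.ker α.curryLeft

theorem mem_contractionKer {k : ℕ} {α : Form E M k} {Z : ComplexVectorField E M} :
    Z ∈ contractionKer α ↔ interior Z k α = 0 := by
  cases k with
  | zero => simp [contractionKer, interior]
  | succ k => exact LinearMap.mem_ker

theorem apply_eq_zero_of_mem_contractionKer {k : ℕ} {α : Form E M k}
    {v : Fin k → ComplexVectorField E M} {i : Fin k} (h : v i ∈ contractionKer α) : α v = 0 := by
  cases k with
  | zero => exact i.elim0
  | succ k =>
    rw [← Function.update_eq_self i v, map_update_eq, LinearMap.mem_ker.1 h]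
    simp

/-- The complex vector fields `Z` with `ι(Z) α = 0` and `ι(Z) dα = 0`. -/
def nullFields {k : ℕ} (α : Form E M k) : Submodule (SmoothFun E M) (ComplexVectorField E M) :=
  contractionKer α ⊓ contractionKer (extD k α)

/-- Cartan's formula `L_Z = ι(Z) d + d ι(Z)`, which in positive degree is `koszul_succ`, with the
last term zero. -/
theorem lieDeriv_eq_curryLeft_extD {k : ℕ} {α : Form E M k} {Z : ComplexVectorField E M}
    (h : Z ∈ contractionKer α) : lieDeriv Z α = (extD k α).curryLeft Z := by
  ext1 v
  change _ = koszul α (Fin.cons Z v : Fin (k + 1) → ComplexVectorField E M)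
  cases k with
  | zero => rw [koszul_zero, lieDeriv_apply]; simp [Subsingleton.elim v Fin.elim0]
  | succ k =>
    rw [koszul_succ, LinearMap.mem_ker.1 h, ← extD_apply, map_zero]
    simp

/-- Passes between the condition linear over functions, used for pointwise spans and types, and the
one with Lie derivatives, used for brackets and for `basicForms`. -/
theorem mem_nullFields {k : ℕ} {α : Form E M k} {Z : ComplexVectorField E M} :
    Z ∈ nullFields α ↔ interior Z k α = 0 ∧ lieDeriv Z α = 0 := by
  rw [nullFields, Submodule.mem_inf, ← mem_contractionKer]
  refine and_congr_right fun h => ?_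
  rw [lieDeriv_eq_curryLeft_extD h]
  exact LinearMap.mem_ker

theorem mem_basicForms {k : ℕ} {D : Set (ComplexVectorField E M)} {α : Form E M k} :
    α ∈ basicForms k D ↔ D ⊆ nullFields α :=
  forall₂_congr fun _ _ => mem_nullFields.symm

/-- Both conditions follow from commutators: `L_[Z,W] = [L_Z, L_W]` and `ι([Z, W]) = [L_Z, ι(W)]`.
-/
theorem bracket_mem_nullFields [T2Space M] {k : ℕ} {α : Form E M k} {Z W : ComplexVectorField E M}
    (hZ : Z ∈ nullFields α) (hW : W ∈ nullFields α) : bracket Z W ∈ nullFields α := by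
  rw [mem_nullFields] at hZ hW ⊢
  have h0 (Z : ComplexVectorField E M) (k) : lieDeriv Z (0 : Form E M k) = 0 := by
    have h := lieDeriv_sub k Z 0 0
    rwa [sub_self, sub_self] at h
  refine ⟨?_, by rw [lieDeriv_bracket, hZ.2, hW.2, h0, h0, sub_zero]⟩
  cases k with
  | zero => rfl
  | succ k =>
    have h := curryLeft_lieDeriv Z W α
    have h1 : α.curryLeft W = 0 := hW.1
    rw [hZ.2, h1, h0] at h
    simpa [interior] using h.symm

theorem complex_smul_mem {K : Submodule (SmoothFun E M) (ComplexVectorField E M)} (c : ℂ)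
    {Z : ComplexVectorField E M} (h : Z ∈ K) : c • Z ∈ K :=
  K.smul_mem _ h

/-- The null fields of a form contain the real vector fields with values in the pointwise span of
null fields. -/
theorem cvf_mem_nullFields_of_mem_span [T2Space M] {k : ℕ} {α : Form E M k}
    (A : Set (RealVectorField E M)) (hA : ∀ X ∈ A, cvf X 0 ∈ nullFields α)
    (W : RealVectorField E M)
    (hW : ∀ x, W x ∈ Submodule.span ℝ {v : TangentSpace 𝓘(ℝ, E) x | ∃ X ∈ A, v = X x}) :
    cvf W 0 ∈ nullFields α := by
  have key {n : ℕ} (β : Form E M n) (hβ : ∀ X ∈ A, cvf X 0 ∈ contractionKer β) :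
      cvf W 0 ∈ contractionKer β := by
    cases n with
    | zero => trivial
    | succ n =>
      refine LinearMap.mem_ker.2 (AlternatingMap.ext fun v => ?_)
      -- With the other arguments fixed, contraction is linear over functions, so pointwise spans
      -- can be handled. This applies to `α` and to `dα` alike, whereas `L_Z α` is not linear over
      -- functions in `Z`.
      let L : ComplexVectorField E M →ₗ[SmoothFun E M] SmoothFun E M :=
        { toFun := fun Z => β.curryLeft Z v
          map_add' := fun Z Z' => by rw [map_add]; rfl
          map_smul' := fun f Z => by rw [map_smul]; rfl }
      refine linearMap_eq_zero_of_mem_span L A (fun X hX => ?_) W hW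
      change β.curryLeft (cvf X 0) v = 0
      rw [LinearMap.mem_ker.1 (hβ X hX)]
      rfl
  exact ⟨key _ fun X hX => (hA X hX).1, key _ fun X hX => (hA X hX).2⟩

/-- Each term of the Koszul formula vanishes by itself. A derivative term loses the argument `v i`,
and `h₁` leaves another one killing `α`. A bracket term loses `v i` and has `v j` replaced by the
bracket; `h₂` provides either an untouched argument killing `α` or a bracket that does. -/
theorem koszul_eq_zero {k : ℕ} (α : Form E M k) (v : Fin (k + 1) → ComplexVectorField E M)
    (h₁ : ∀ i, ∃ l, l ≠ i ∧ v l ∈ contractionKer α)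
    (h₂ : ∀ i j, i < j → (∃ l, l ≠ i ∧ l ≠ j ∧ v l ∈ contractionKer α) ∨
      bracket (v i) (v j) ∈ contractionKer α) : koszul α v = 0 := by
  have key (i : Fin (k + 1)) (w : Fin (k + 1) → ComplexVectorField E M)
      (h : ∃ l, l ≠ i ∧ w l ∈ contractionKer α) : α (i.removeNth w) = 0 := by
    obtain ⟨l, hl, hw⟩ := h
    obtain ⟨m, rfl⟩ := Fin.exists_succAbove_eq hl
    exact apply_eq_zero_of_mem_contractionKer (i := m) hw
  refine Finset.sum_eq_zero fun i _ => ?_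
  rw [key i v (h₁ i), act_zero, Finset.sum_eq_zero, sub_zero, mul_zero]
  intro j hj
  have hij := Finset.mem_Ioi.1 hj
  apply key
  rcases h₂ i j hij with ⟨l, hli, hlj, hl⟩ | h
  · exact ⟨l, hli, by rwa [Function.update_of_ne hlj]⟩
  · exact ⟨j, hij.ne', by rwa [Function.update_self]⟩

namespace AlmostComplexStructure

variable (j : AlmostComplexStructure E M)

/-! ### The projections to the two types -/

theorem onReal_onReal (X : RealVectorField E M) : j.onReal (j.onReal X) = -X := by
  ext x
  exact j.sq x (X x)

theorem onReal_add (X Y : RealVectorField E M) : j.onReal (X + Y) = j.onReal X + j.onReal Y := by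
  ext x
  simp

theorem onReal_neg (X : RealVectorField E M) : j.onReal (-X) = -j.onReal X := by
  ext x
  simp

theorem onComplex_onComplex (Z : ComplexVectorField E M) : j.onComplex (j.onComplex Z) = -Z :=
  Prod.ext (j.onReal_onReal Z.re) (j.onReal_onReal Z.im)

theorem proj10_apply (Z : ComplexVectorField E M) :
    j.proj10 Z = (1 / 2 : ℂ) • (Z - Complex.I • j.onComplex Z) := rfl

theorem proj01_apply (Z : ComplexVectorField E M) :
    j.proj01 Z = (1 / 2 : ℂ) • (Z + Complex.I • j.onComplex Z) := rfl

theorem mem_T10 {Z : ComplexVectorField E M} : Z ∈ j.T10 ↔ j.onComplex Z = Complex.I • Z := Iff.rfl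

theorem mem_T01 {Z : ComplexVectorField E M} : Z ∈ j.T01 ↔ j.onComplex Z = -(Complex.I • Z) :=
  Iff.rfl

theorem I_smul_I_smul (Z : ComplexVectorField E M) : Complex.I • Complex.I • Z = -Z := by
  rw [smul_smul, Complex.I_mul_I, neg_one_smul]

theorem proj10_mem (Z : ComplexVectorField E M) : j.proj10 Z ∈ j.T10 := by
  rw [mem_T10, proj10_apply, onComplex_smul, map_sub, onComplex_smul, onComplex_onComplex,
    smul_comm Complex.I (1 / 2 : ℂ), smul_sub Complex.I, I_smul_I_smul]
  module

theorem proj01_mem (Z : ComplexVectorField E M) : j.proj01 Z ∈ j.T01 := by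
  rw [mem_T01, proj01_apply, onComplex_smul, map_add, onComplex_smul, onComplex_onComplex,
    smul_comm Complex.I (1 / 2 : ℂ), smul_add Complex.I, I_smul_I_smul]
  module

theorem proj10_add_proj01 (Z : ComplexVectorField E M) : j.proj10 Z + j.proj01 Z = Z := by
  rw [proj10_apply, proj01_apply]
  module

theorem proj10_of_mem_T01 {Z : ComplexVectorField E M} (h : Z ∈ j.T01) : j.proj10 Z = 0 := by
  rw [proj10_apply, j.mem_T01.1 h, smul_neg, I_smul_I_smul]
  module

theorem proj01_of_mem_T10 {Z : ComplexVectorField E M} (h : Z ∈ j.T10) : j.proj01 Z = 0 := by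
  rw [proj01_apply, j.mem_T10.1 h, I_smul_I_smul]
  module

theorem proj10_of_mem_T10 {Z : ComplexVectorField E M} (h : Z ∈ j.T10) : j.proj10 Z = Z := by
  simpa [j.proj01_of_mem_T10 h] using j.proj10_add_proj01 Z

theorem proj01_of_mem_T01 {Z : ComplexVectorField E M} (h : Z ∈ j.T01) : j.proj01 Z = Z := by
  simpa [j.proj10_of_mem_T01 h] using j.proj10_add_proj01 Z

/-- A family of vector fields is of type `S` if its members are sections of `T_j^{1,0}` at the
indices in `S`, and of `T_j^{0,1}` at the others. -/
def IsTypeFamily {k : ℕ} (S : Finset (Fin k)) (Z : Fin k → ComplexVectorField E M) : Prop :=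
  (∀ i ∈ S, Z i ∈ j.T10) ∧ ∀ i ∉ S, Z i ∈ j.T01

/-- Split every argument into its two projections and expand by multilinearity; each summand is a
family of some type `S`. -/
theorem form_eq_zero {k : ℕ} {β : Form E M k} (h : ∀ S Z, j.IsTypeFamily S Z → β Z = 0) :
    β = 0 := by
  classical
  ext1 Z
  have hZ : Z = (fun i => j.proj10 (Z i)) + fun i => j.proj01 (Z i) :=
    funext fun i => (j.proj10_add_proj01 (Z i)).symm
  rw [hZ, AlternatingMap.map_add_univ]
  refine Finset.sum_eq_zero fun S _ => h S _ ⟨fun i hi => ?_, fun i hi => ?_⟩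
  · rw [Finset.piecewise_eq_of_mem _ _ _ hi]; exact j.proj10_mem _
  · rw [Finset.piecewise_eq_of_notMem _ _ _ hi]; exact j.proj01_mem _

/-- On a family of type `S`, every summand of `typeProjFun` indexed by `S' ≠ S` has a zero argument,
and the summand for `S` is `β Z`. Conversely, each summand evaluates `β` on a family of its own
type. -/
theorem typeProj_eq_zero_iff {k : ℕ} {p q : ℤ} {β : Form E M k} :
    j.typeProj k p q β = 0 ↔ ∀ (S : Finset (Fin k)) (Z : Fin k → ComplexVectorField E M),
      (S.card : ℤ) = p → (Sᶜ.card : ℤ) = q → j.IsTypeFamily S Z → β Z = 0 := by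
  classical
  constructor
  · intro h S Z hp hq hZ
    have h' : j.typeProjFun p q β Z = 0 := congrArg (fun γ : Form E M k => γ Z) h
    rw [typeProjFun, Finset.sum_eq_single S] at h'
    · convert h' using 2
      funext i
      split_ifs with hi
      · exact (j.proj10_of_mem_T10 (hZ.1 i hi)).symm
      · exact (j.proj01_of_mem_T01 (hZ.2 i hi)).symm
    · intro S' _ hne
      obtain ⟨i, hi⟩ : ∃ i, ¬ (i ∈ S' ↔ i ∈ S) := by
        by_contra! hc
        exact hne (Finset.ext hc)
      refine β.map_coord_zero i ?_
      by_cases hS : i ∈ S <;> by_cases hS' : i ∈ S'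
      · exact absurd (iff_of_true hS' hS) hi
      · rw [if_neg hS', j.proj01_of_mem_T10 (hZ.1 i hS)]
      · rw [if_pos hS', j.proj10_of_mem_T01 (hZ.2 i hS)]
      · exact absurd (iff_of_false hS' hS) hi
    · intro hS
      exact absurd (Finset.mem_filter.2 ⟨Finset.mem_univ S, hp, hq⟩) hS
  · intro h
    ext1 Z
    change j.typeProjFun p q β Z = 0
    refine Finset.sum_eq_zero fun S hS => ?_
    obtain ⟨hp, hq⟩ := (Finset.mem_filter.1 hS).2
    refine h S _ hp hq ⟨fun i hi => ?_, fun i hi => ?_⟩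
    · simpa only [if_pos hi] using j.proj10_mem _
    · simpa only [if_neg hi] using j.proj01_mem _

/-- Placing `Z` in slot `0` before a family of type `S` gives a family whose type is the shift of
`S`; it misses `0`, so it is not everything. -/
theorem mem_contractionKer_of_mem_T01 : ∀ {k : ℕ} {β : Form E M k},
    (∀ S Z, j.IsTypeFamily S Z → S ≠ Finset.univ → β Z = 0) →
    ∀ Z ∈ j.T01, Z ∈ contractionKer β
  | 0, _, _, _, _ => trivial
  | k + 1, β, h, Z, hZ => by
    refine LinearMap.mem_ker.2 (j.form_eq_zero fun S v hv => ?_)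
    refine h (S.map (Fin.succEmb k)) (Fin.cons Z v : Fin (k + 1) → ComplexVectorField E M)
      ⟨?_, ?_⟩ ?_
    · intro i hi
      obtain ⟨l, hl, rfl⟩ := Finset.mem_map.1 hi
      exact hv.1 l hl
    · intro i hi
      cases i using Fin.cases with
      | zero => exact hZ
      | succ l => exact hv.2 l fun hl => hi (Finset.mem_map_of_mem (Fin.succEmb k) hl)
    · intro hS
      obtain ⟨l, -, hl⟩ := Finset.mem_map.1 (hS ▸ Finset.mem_univ (0 : Fin (k + 1)))
      exact Fin.succ_ne_zero l hl

theorem apply_eq_zero_of_isTypeFamily {k : ℕ} {β : Form E M k}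
    (h : ∀ Z ∈ j.T01, Z ∈ contractionKer β) {S : Finset (Fin k)}
    {Z : Fin k → ComplexVectorField E M} (hZ : j.IsTypeFamily S Z) (hS : S ≠ Finset.univ) :
    β Z = 0 := by
  obtain ⟨i, hi⟩ : ∃ i, i ∉ S := by
    by_contra! hc
    exact hS (Finset.eq_univ_iff_forall.2 hc)
  exact apply_eq_zero_of_mem_contractionKer (h _ (hZ.2 i hi))

/-- Among `k`-forms, type `(k, 0)` leaves only the index set `Finset.univ`, so any argument in
`T_j^{0,1}` must give zero. -/
theorem mem_typeForms_iff {k : ℕ} {α : Form E M k} :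
    α ∈ j.typeForms k k 0 ↔ ∀ Z ∈ j.T01, Z ∈ contractionKer α := by
  constructor
  · intro h
    refine j.mem_contractionKer_of_mem_T01 fun S Z hZ hS => h S Z (fun hc => hS ?_) hZ.1 hZ.2
    simpa using hc.2
  · intro h S Z hS h10 h01
    refine j.apply_eq_zero_of_isTypeFamily h ⟨h10, h01⟩ fun hc => hS ?_
    simp [hc]

/-- No complement has negative cardinality, so the form must vanish on families of every type. -/
theorem typeForms_eq_bot_of_neg (k : ℕ) (p : ℤ) {q : ℤ} (hq : q < 0) :
    j.typeForms k p q = ⊥ := by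
  rw [eq_bot_iff]
  intro α hα
  exact j.form_eq_zero fun S Z hZ => hα S Z (by omega) hZ.1 hZ.2

/-- A form of type `(k, 0)` with `μ̄ α = 0` and `∂̄ α = 0` is annihilated by the sections of
`T_j^{0,1}`, together with its exterior derivative. -/
theorem mem_nullFields_of_mem_T01 {k : ℕ} {α : Form E M k}
    (hα : ∀ Z ∈ j.T01, Z ∈ contractionKer α)
    (h₁ : j.delBar k k 0 α = 0) (h₂ : j.muBar k k 0 α = 0) :
    ∀ Z ∈ j.T01, Z ∈ nullFields α := by
  refine fun Z hZ => ⟨hα Z hZ, j.mem_contractionKer_of_mem_T01 (fun S v hv hS => ?_) Z hZ⟩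
  have hcard : S.card + Sᶜ.card = k + 1 := by simp
  have hpos : Sᶜ.card ≠ 0 := by simpa using hS
  -- A Koszul term uses up at most two arguments, so with three or more from `T_j^{0,1}` one
  -- survives and kills `α`. Exactly one or two such arguments are the components `∂̄ α` and `μ̄ α`.
  rcases lt_or_ge 2 Sᶜ.card with h3 | h3
  · refine koszul_eq_zero α v (fun i => ?_) fun i l _ => Or.inl ?_
    · obtain ⟨m, hm, hmi⟩ := Finset.exists_mem_notMem_of_card_lt_card (s := {i}) (t := Sᶜ)
        (by rw [Finset.card_singleton]; omega)
      exact ⟨m, by simpa using hmi, hα _ (hv.2 m (Finset.mem_compl.1 hm))⟩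
    · obtain ⟨m, hm, hmi⟩ := Finset.exists_mem_notMem_of_card_lt_card (s := {i, l}) (t := Sᶜ)
        (Finset.card_le_two.trans_lt h3)
      simp only [Finset.mem_insert, Finset.mem_singleton, not_or] at hmi
      exact ⟨m, hmi.1, hmi.2, hα _ (hv.2 m (Finset.mem_compl.1 hm))⟩
  · rcases (show Sᶜ.card = 1 ∨ Sᶜ.card = 2 by omega) with h | h
    · exact j.typeProj_eq_zero_iff.1 h₁ S v (by omega) (by omega) hv
    · exact j.typeProj_eq_zero_iff.1 h₂ S v (by omega) (by omega) hv

/-- `μ̄ α` is tested on families with exactly two arguments from `T_j^{0,1}`. The only Koszul term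
in which neither survives is the one containing their bracket. -/
theorem muBar_eq_zero_of_bracket {k : ℕ} {α : Form E M k}
    (hα : ∀ Z ∈ j.T01, Z ∈ contractionKer α)
    (hb : ∀ Z ∈ j.T01, ∀ W ∈ j.T01, bracket Z W ∈ contractionKer α) :
    j.muBar k k 0 α = 0 := by
  refine j.typeProj_eq_zero_iff.2 fun S v _ hS hv => ?_
  refine koszul_eq_zero α v (fun i => ?_) fun i l hil => ?_
  · obtain ⟨m, hm, hmi⟩ := Finset.exists_mem_notMem_of_card_lt_card (s := {i}) (t := Sᶜ)
      (by rw [Finset.card_singleton]; omega)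
    exact ⟨m, by simpa using hmi, hα _ (hv.2 m (Finset.mem_compl.1 hm))⟩
  · by_cases h : i ∈ Sᶜ ∧ l ∈ Sᶜ
    · exact Or.inr (hb _ (hv.2 i (Finset.mem_compl.1 h.1)) _ (hv.2 l (Finset.mem_compl.1 h.2)))
    · left
      by_contra! hc
      -- If nothing outside `{i, l}` kills `α`, the two `T_j^{0,1}`-slots are `i` and `l`
      -- themselves, the case already treated.
      have hsub : Sᶜ ⊆ {i, l} := by
        intro m hm
        by_contra hm'
        simp only [Finset.mem_insert, Finset.mem_singleton, not_or] at hm'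
        exact hc m hm'.1 hm'.2 (hα _ (hv.2 m (Finset.mem_compl.1 hm)))
      have heq : Sᶜ = {i, l} := Finset.eq_of_subset_of_card_le hsub
        (Finset.card_le_two.trans (by omega))
      exact h (by simp [heq])

/-- Both components have `q > 0`, so they are tested on families with an argument in `T_j^{0,1}`,
and such an argument kills `dα`. -/
theorem delBar_eq_zero_and_muBar_eq_zero {k : ℕ} {α : Form E M k}
    (hα : ∀ Z ∈ j.T01, Z ∈ nullFields α) :
    j.delBar k k 0 α = 0 ∧ j.muBar k k 0 α = 0 := by
  have key (p q : ℤ) (hq : 0 < q) : j.typeProj (k + 1) p q (extD k α) = 0 := by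
    refine j.typeProj_eq_zero_iff.2 fun S v _ hS hv =>
      j.apply_eq_zero_of_isTypeFamily (fun Z hZ => (hα Z hZ).2) hv fun hc => ?_
    simp [hc] at hS
    omega
  exact ⟨key _ _ (by omega), key _ _ (by omega)⟩

/-! ### Brackets of sections of `T_j^{0,1}` -/

/-- For `Z = X + i Y`, the eigenvalue equation says `jX = Y` and `jY = -X`; the second follows from
the first by `j² = -1`. So these sections are exactly the `X + i jX`. -/
theorem mem_T01_iff {Z : ComplexVectorField E M} : Z ∈ j.T01 ↔ Z.im = j.onReal Z.re := by
  have hI : -(Complex.I • Z) = cvf Z.im (-Z.re) := by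
    rw [complex_smul_def]
    have h := add_neg_cancel (algebraMap ℂ (SmoothFun E M) Complex.I • Z)
    refine neg_eq_of_add_eq_zero_right ?_
    apply cvf_ext <;> intro x <;> simp [-algebraMap_smul]
  rw [mem_T01, hI]
  constructor
  · exact fun h => (congrArg Prod.fst h).symm
  · intro h
    refine Prod.ext h.symm ?_
    change j.onReal Z.im = -Z.re
    rw [h, onReal_onReal]

/-- For `Z = X + i jX` and `W = Y + i jY`, adding `N^j(X, Y)` turns the real part of the bracket
into `-j([X, jY] + [jX, Y])`, whose image under `j` is the imaginary part. -/
theorem bracket_add_nijenhuis_mem_T01 {Z W : ComplexVectorField E M} (hZ : Z ∈ j.T01)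
    (hW : W ∈ j.T01) : bracket Z W + cvf (j.nijenhuis Z.re W.re) 0 ∈ j.T01 := by
  rw [mem_T01_iff] at hZ hW ⊢
  simp only [bracket, hZ, hW, nijenhuis, onReal_onReal, add_re, add_im, cvf_re, cvf_im]
  have h : realBracket Z.re W.re - realBracket (j.onReal Z.re) (j.onReal W.re) +
      (realBracket (j.onReal Z.re) (j.onReal W.re) - j.onReal (realBracket (j.onReal Z.re) W.re) -
        j.onReal (realBracket Z.re (j.onReal W.re)) + -realBracket Z.re W.re) =
      -j.onReal (realBracket Z.re (j.onReal W.re) + realBracket (j.onReal Z.re) W.re) := by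
    rw [onReal_add]; abel
  rw [h, onReal_neg, onReal_onReal]
  simp

theorem I_smul_cvf (X : RealVectorField E M) : Complex.I • cvf X 0 = cvf 0 X := by
  rw [complex_smul_def]
  apply cvf_ext <;> intro x <;> simp [-algebraMap_smul]

/-- `[U, X + i jX] = [U, X] + i [U, jX]`, and subtracting `i (L_U j) X` replaces `[U, jX]` by `j[U,
X]`. Thus `(L_U j) X` is reached from `T_j^{0,1}` and brackets of `U` with it. -/
theorem bracket_sub_lieDerivJ_mem_T01 (U X : RealVectorField E M) :
    bracket (cvf U 0) (cvf X (j.onReal X)) - Complex.I • cvf (j.lieDerivJ U X) 0 ∈ j.T01 := by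
  have h0 (Y : RealVectorField E M) : realBracket 0 Y = 0 := by
    simpa using realBracket_sub_left 0 0 Y
  rw [I_smul_cvf, mem_T01_iff, bracket]
  change _ - j.lieDerivJ U X = j.onReal (_ - 0)
  simp only [h0, lieDerivJ, cvf_re, cvf_im, sub_zero, add_zero]
  exact sub_sub_cancel _ _

/-! ### Both kinds of cocycles are the forms annihilated by the limit distribution -/

/-- Null fields are closed under brackets and complex combinations, so containing stage `0` of the
derived flag forces all later stages. -/
theorem mem_limitForms_iff [T2Space M] {p : ℕ} {α : Form E M p} :
    α ∈ j.limitForms p ↔ ∀ Z ∈ j.T01, Z ∈ nullFields α := by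
  rw [limitForms, mem_basicForms]
  constructor
  · exact fun h Z hZ => h (Set.mem_iUnion.2 ⟨0, hZ⟩)
  · intro h Z hZ
    obtain ⟨n, hn⟩ := Set.mem_iUnion.1 hZ
    have key (n : ℕ) : ∀ Z ∈ j.derivedT01 n, Z ∈ nullFields α := by
      induction n with
      | zero => exact h
      | succ n ih =>
        have hle : j.derivedT01 (n + 1) ≤ (nullFields α).restrictScalars ℂ := by
          refine sup_le ih (Submodule.span_le.2 ?_)
          rintro _ ⟨Z, hZ, Z', hZ', rfl⟩
          exact bracket_mem_nullFields (ih Z hZ) (ih Z' hZ')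
        exact hle
    exact key n Z hn

/-- The real vector fields that are null fields of a form. -/
def realNullFields {k : ℕ} (α : Form E M k) : Submodule ℝ (RealVectorField E M) where
  carrier := {X | cvf X 0 ∈ nullFields α}
  add_mem' hX hY := by
    rw [Set.mem_ofPred_eq, cvf_add_zero]
    exact add_mem hX hY
  zero_mem' := (nullFields α).zero_mem
  smul_mem' c X hX := by
    rw [Set.mem_ofPred_eq, ofReal_smul_cvf]
    exact complex_smul_mem _ hX

/-- Induction along the flag of `D_j^∞`: modulo `T_j^{0,1}`, `N^j(X, Y)` is minus a bracket of
sections of `T_j^{0,1}`, and `i (L_U j) X` is a bracket of `U` with one. -/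
theorem limitReal_subset [T2Space M] {p : ℕ} {α : Form E M p}
    (hα : ∀ Z ∈ j.T01, Z ∈ nullFields α) : ∀ X ∈ j.limitReal, cvf X 0 ∈ nullFields α := by
  have hmem (X : RealVectorField E M) : cvf X (j.onReal X) ∈ j.T01 := j.mem_T01_iff.2 rfl
  have key (n : ℕ) : j.derivedReal n ≤ realNullFields α := by
    induction n with
    | zero =>
      intro W hW
      -- The first stage is defined by pointwise spans, so its members need not be global
      -- combinations of values of `N^j`; tensoriality bridges the gap.
      refine cvf_mem_nullFields_of_mem_span {N | ∃ X Y, N = j.nijenhuis X Y} ?_ W fun x => ?_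
      · rintro _ ⟨X, Y, rfl⟩
        have h := hα _ (j.bracket_add_nijenhuis_mem_T01 (hmem X) (hmem Y))
        exact ((nullFields α).add_mem_iff_right
          (bracket_mem_nullFields (hα _ (hmem X)) (hα _ (hmem Y)))).1 h
      · refine Submodule.span_mono ?_ (hW x)
        rintro v ⟨X, Y, rfl⟩
        exact ⟨_, ⟨X, Y, rfl⟩, rfl⟩
    | succ n ih =>
      refine sup_le (sup_le ih (Submodule.span_le.2 ?_)) (Submodule.span_le.2 ?_)
      · rintro _ ⟨U, hU, X, rfl⟩
        have h := hα _ (j.bracket_sub_lieDerivJ_mem_T01 U X)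
        have h' := ((nullFields α).sub_mem_iff_right
          (bracket_mem_nullFields (ih hU) (hα _ (hmem X)))).1 h
        have h2 := complex_smul_mem (-Complex.I) h'
        rwa [neg_smul, I_smul_I_smul, neg_neg] at h2
      · rintro _ ⟨U, hU, U', hU', rfl⟩
        have h := bracket_mem_nullFields (ih hU) (ih hU')
        have h0 (Y : RealVectorField E M) : realBracket Y 0 = 0 := by
          simpa using realBracket_sub_right Y 0 0
        have he : bracket (cvf U 0) (cvf U' 0) = cvf (realBracket U U') 0 := by
          simp [bracket, h0, realBracket_swap 0 U']
        rwa [he] at h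
  intro X hX
  obtain ⟨n, hn⟩ := Set.mem_iUnion.1 hX
  exact key n hn

/-- Transversality supplies the missing equation `μ̄ α = 0`: contraction with `N^j` vanishes, hence
so does contraction with brackets of sections of `T_j^{0,1}`. -/
theorem mem_transCocycles_iff [T2Space M] {p : ℕ} {α : Form E M p} :
    α ∈ j.transCocycles p p 0 ↔ ∀ Z ∈ j.T01, Z ∈ nullFields α := by
  constructor
  · rintro ⟨⟨ht, hb⟩, hd⟩
    have h10 := j.mem_typeForms_iff.1 ht
    refine j.mem_nullFields_of_mem_T01 h10 hd (j.muBar_eq_zero_of_bracket h10 ?_)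
    intro Z hZ W hW
    -- Index `0` is the stage `D_j^{(1)}`; this direction needs nothing beyond it.
    have hN : j.nijenhuis Z.re W.re ∈ j.limitReal :=
      Set.mem_iUnion.2 ⟨0, fun x => Submodule.subset_span ⟨_, _, rfl⟩⟩
    have hN' := (mem_basicForms.1 hb (Set.mem_image_of_mem _ hN)).1
    exact ((contractionKer α).add_mem_iff_left hN').1
      (h10 _ (j.bracket_add_nijenhuis_mem_T01 hZ hW))
  · intro h
    refine ⟨⟨j.mem_typeForms_iff.2 fun Z hZ => (h Z hZ).1, mem_basicForms.2 ?_⟩,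
      (j.delBar_eq_zero_and_muBar_eq_zero h).1⟩
    rintro _ ⟨X, hX, rfl⟩
    exact j.limitReal_subset h X hX

/-! ### Vanishing of boundaries in bidegree `(p, 0)` and bijectivity of the class maps -/

theorem muIm_eq_bot (k : ℕ) (p : ℤ) {q : ℤ} (hq : q < 2) : j.muIm k p q = ⊥ := by
  cases k with
  | zero => rfl
  -- The source has second degree `q - 2 < 0`. Both `q = 0` and `q = 1` are needed: the quotient
  -- defining `H_μ̄` and the target of the induced `∂̄`.
  | succ k => rw [muIm, j.typeForms_eq_bot_of_neg k _ (by omega), Submodule.map_bot]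

theorem dolBoundaries_eq_bot (k : ℕ) (p : ℤ) : j.dolBoundaries k p 0 = ⊥ := by
  cases k with
  | zero => rfl
  | succ k =>
    rw [dolBoundaries, muKer, j.typeForms_eq_bot_of_neg k _ (by omega), bot_inf_eq,
      Submodule.map_bot]

theorem transBoundaries_eq_bot (k : ℕ) (p : ℤ) : j.transBoundaries k p 0 = ⊥ := by
  cases k with
  | zero => rfl
  | succ k =>
    rw [transBoundaries, transForms, j.typeForms_eq_bot_of_neg k _ (by omega), bot_inf_eq,
      Submodule.map_bot]

/-- The condition that `∂̄ α` lies in the image of `μ̄` collapses to `∂̄ α = 0`, because that image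
comes from bidegree `(p + 1, -1)`. -/
theorem mem_dolCocycles_iff {p : ℕ} {α : Form E M p} :
    α ∈ j.dolCocycles p p 0 ↔ ∀ Z ∈ j.T01, Z ∈ nullFields α := by
  rw [dolCocycles, muIm_eq_bot j _ _ (by norm_num)]
  constructor
  · rintro ⟨⟨ht, hm⟩, hd⟩
    exact j.mem_nullFields_of_mem_T01 (j.mem_typeForms_iff.1 ht) hd hm
  · intro h
    obtain ⟨hd, hm⟩ := j.delBar_eq_zero_and_muBar_eq_zero h
    exact ⟨⟨j.mem_typeForms_iff.2 fun Z hZ => (h Z hZ).1, hm⟩, hd⟩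

theorem transClass_bijective (k : ℕ) (p : ℤ) : Function.Bijective (j.transClass k p 0) := by
  refine ⟨?_, Submodule.mkQ_surjective _⟩
  rw [← LinearMap.ker_eq_bot, transClass, Submodule.ker_mkQ, transBoundaries_eq_bot]
  simp [Submodule.submoduleOf]

/-- Two successive quotients are taken, by the image of `μ̄` and by that of the induced `∂̄`; for `q
= 0` both are by zero. -/
theorem dolClass_bijective (k : ℕ) (p : ℤ) : Function.Bijective (j.dolClass k p 0) := by
  have hmu : (j.muIm k p 0).submoduleOf (j.muKer k p 0) = ⊥ := by
    rw [j.muIm_eq_bot k p (by norm_num)]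
    simp [Submodule.submoduleOf]
  have him : j.dolIm k p 0 = ⊥ := by
    have hb : (⊥ : Submodule ℂ (Form E M k)).submoduleOf (j.muKer k p 0) = ⊥ := by
      simp [Submodule.submoduleOf]
    rw [dolIm, dolBoundaries_eq_bot, hb, Submodule.map_bot]
  constructor
  · rw [← LinearMap.ker_eq_bot, eq_bot_iff]
    intro α hα
    have h1 : j.dolKerMk k p 0 α ∈ (j.dolIm k p 0).submoduleOf (j.dolKer k p 0) :=
      (Submodule.Quotient.mk_eq_zero _).1 hα
    rw [him] at h1
    have h2 : Submodule.inclusion (inf_le_left : j.dolCocycles k p 0 ≤ j.muKer k p 0) α ∈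
        (j.muIm k p 0).submoduleOf (j.muKer k p 0) :=
      (Submodule.Quotient.mk_eq_zero _).1 h1
    rw [hmu] at h2
    have h3 : (Submodule.inclusion inf_le_left α : j.muKer k p 0) = 0 := (Submodule.mem_bot ℂ).1 h2
    exact Subtype.ext (congrArg (Subtype.val (p := (· ∈ j.muKer k p 0))) h3 : α.1 = 0)
  · refine (Submodule.mkQ_surjective _).comp ?_
    rintro ⟨_, α, hα, rfl⟩
    exact ⟨⟨α.1, hα⟩, rfl⟩

end AlmostComplexStructure

end AlmostComplex

end

theorem mainTheorem1 {E : Type*} [NormedAddCommGroup E] [NormedSpace ℝ E] [FiniteDimensional ℝ E]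
    {M : Type*} [TopologicalSpace M] [T2Space M] [SigmaCompactSpace M] [ChartedSpace E M]
    [IsManifold 𝓘(ℝ, E) ∞ M] (j : AlmostComplex.AlmostComplexStructure E M) (p : ℕ) :
    (∃ e : j.TransCohomology p p 0 ≃ₗ[ℂ] j.DolCohomology p p 0,
      ∀ (α : AlmostComplex.Form E M p) (ht : α ∈ j.transCocycles p p 0)
        (hd : α ∈ j.dolCocycles p p 0),
        e (j.transClass p p 0 ⟨α, ht⟩) = j.dolClass p p 0 ⟨α, hd⟩) ∧
    (j.transCocycles p p 0 = j.limitForms p ∧ Function.Bijective (j.transClass p p 0)) ∧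
    (j.dolCocycles p p 0 = j.limitForms p ∧ Function.Bijective (j.dolClass p p 0)) := by
  have ht : j.transCocycles p p 0 = j.limitForms p :=
    Submodule.ext fun α => j.mem_transCocycles_iff.trans j.mem_limitForms_iff.symm
  have hd : j.dolCocycles p p 0 = j.limitForms p :=
    Submodule.ext fun α => j.mem_dolCocycles_iff.trans j.mem_limitForms_iff.symm
  have htb := j.transClass_bijective p p
  have hdb := j.dolClass_bijective p p
  -- Both class maps are bijective on one and the same space of forms, so composing the inverse of
  -- one with the other keeps the representative.
  refine ⟨⟨(LinearEquiv.ofBijective _ htb).symm ≪≫ₗ LinearEquiv.ofEq _ _ (ht.trans hd.symm) ≪≫ₗ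
    LinearEquiv.ofBijective _ hdb, fun α hα hα' => ?_⟩, ⟨ht, htb⟩, hd, hdb⟩
  have h : (LinearEquiv.ofBijective _ htb).symm (j.transClass p p 0 ⟨α, hα⟩) = ⟨α, hα⟩ :=
    (LinearEquiv.ofBijective _ htb).symm_apply_apply ⟨α, hα⟩
  rw [LinearEquiv.trans_apply, LinearEquiv.trans_apply, h]
  rfl
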